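/- A virtual knot is a knot diagram in the plane with classical and virtual crossings, up to planar isotopy and the generalized Reidemeister moves (R1, R2, R3, the virtual moves VR1, VR2, VR3 and the mixed move MR). A crossing change exchanges the overstrand and the understrand at a classical crossing. A virtual knot is virtually null-homotopic if it can be modified into the unknot by generalized Reidemeister moves and crossing changes; its virtual unknotting number $\mathrm{vu}$ is then the minimal number of crossing changes needed. Let $i,j,k$ be integers with $0<j$ and $0\le k<i$. Let $\sigma_m$ be the standard positive generators of the braid group on $i$ strands and $\tau_m$ the corresponding virtual crossings, and read braid words from left to right. Let $VB^1_{i,j}=(\tau_1\tau_2\cdots\tau_{i-1})(\sigma_1\sigma_2\cdots\sigma_{i-1})^{j-1}$, that is, the braid of the standard diagram of the $(i,j)$-torus link with all classical crossings on its left-most overstrand changed into virtual crossings. Let $B_k=\sigma_k\sigma_{k-1}\cdots\sigma_1$, and let $(i,j,k)$ be the closure of the product of $VB^1_{i,j}$ and $B_k$. **Theorem.** If $(i,j,k)$ has only one link component, i.e. is a virtual knot, then it is virtually null-homotopic and $$\mathrm{vu}((i,j,k))=\frac{(i-1)(j-1)+k}{2}.$$ -/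

import Mathlib

/-!
# Virtual link diagrams in the plane

A generic diagram in the plane is swept out by a vertical line that moves from left to right.
Between two events the line meets the diagram in finitely many points, which are numbered
`0, 1, 2, …` from the top.  The events are
* `birth`: a new arc opens to the right (a left-most point of the curve, shape `⊂`),
* `death`: two neighbouring strands are joined (a right-most point, shape `⊃`),
* `cross c`: two neighbouring strands cross.
So a diagram in general position is a finite word of events, each with its position.
Planar isotopy and the generalized Reidemeister moves become local changes of the word.
-/

namespace VirtualKnot

/-- The crossings of two neighbouring strands, both read from left to right.
`over`: the strand that descends to the right is the overstrand (if both strands are oriented to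
the right, the understrand passes from the right to the left of the overstrand, so this is a
positive crossing); `under`: the strand that descends is the understrand; `virt`: a virtual
crossing. -/
inductive Crossing where
  | over
  | under
  | virt

/-- Exchange overstrand and understrand; a virtual crossing stays what it is. -/
def Crossing.flip : Crossing → Crossing
  | .over => .under
  | .under => .over
  | .virt => .virt

/-- The elementary pieces of a diagram. -/
inductive Piece where
  | birth
  | death
  | cross (c : Crossing)

/-- The number of strands that enter an elementary piece from the left. -/
def Piece.inn : Piece → ℕ
  | .birth => 0
  | .death => 2
  | .cross _ => 2

/-- The number of strands that leave an elementary piece to the right. -/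
def Piece.out : Piece → ℕ
  | .birth => 2
  | .death => 0
  | .cross _ => 2

/-- An elementary piece together with the number `pos` of strands that pass above it. -/
structure Event where
  piece : Piece
  pos : ℕ

/-- An arc opens, with `p` strands above it. -/
def birth (p : ℕ) : Event := ⟨.birth, p⟩

/-- The strands `p` and `p + 1` are joined. -/
def death (p : ℕ) : Event := ⟨.death, p⟩

/-- The strands `p` and `p + 1` cross. -/
def cross (c : Crossing) (p : ℕ) : Event := ⟨.cross c, p⟩

/-- The number of strands after the word has been swept, starting with `n` strands
(`none` if some event does not have the strands that it needs). -/
def run : ℕ → List Event → Option ℕ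
  | n, [] => some n
  | n, e :: w => if e.pos + e.piece.inn ≤ n then run (n - e.piece.inn + e.piece.out) w else none

/-- A virtual link diagram in the plane: a word of events that starts and ends with no strand. -/
structure Diagram where
  word : List Event
  closed : run 0 word = some 0

/-! ### Link components -/

/-- The point number `x.2` on the sweeping line after the first `x.1` events. -/
def IsPoint (w : List Event) (x : ℕ × ℕ) : Prop :=
  ∃ n, run 0 (w.take x.1) = some n ∧ x.2 < n

/-- `Joined w x y`: the event number `t` of `w` contains an arc from `x` to `y`. -/
inductive Joined (w : List Event) : ℕ × ℕ → ℕ × ℕ → Prop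
  | above {t : ℕ} {e : Event} (h : w[t]? = some e) (p : ℕ) (hp : p < e.pos) :
      Joined w (t, p) (t + 1, p)
  | below {t : ℕ} {e : Event} (h : w[t]? = some e) (r : ℕ) :
      Joined w (t, e.pos + e.piece.inn + r) (t + 1, e.pos + e.piece.out + r)
  | birth {t p : ℕ} (h : w[t]? = some (birth p)) : Joined w (t + 1, p) (t + 1, p + 1)
  | death {t p : ℕ} (h : w[t]? = some (death p)) : Joined w (t, p) (t, p + 1)
  | down {t p : ℕ} {c : Crossing} (h : w[t]? = some (cross c p)) :
      Joined w (t, p) (t + 1, p + 1)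
  | up {t p : ℕ} {c : Crossing} (h : w[t]? = some (cross c p)) :
      Joined w (t, p + 1) (t + 1, p)

/-- The diagram has exactly one link component, i.e. it is a virtual knot diagram. -/
def Diagram.IsKnot (D : Diagram) : Prop :=
  (∃ x, IsPoint D.word x) ∧
    ∀ x y, IsPoint D.word x → IsPoint D.word y → Relation.EqvGen (Joined D.word) x y

/-! ### Planar isotopy and generalized Reidemeister moves -/

/-- Three strands cross pairwise; counted from the top on the left, `x` is the crossing of the
first with the second, `y` of the first with the third, `z` of the second with the third.  A move
of one strand across the crossing of the other two is allowed in the following cases.  The two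
moves with exactly one virtual crossing (the forbidden moves) are not among them. -/
inductive TriangleMove : Crossing → Crossing → Crossing → Prop
  /-- The classical move R3, with the heights of the strands in any order: the two excluded
  cases are those where each strand is over one of the others and under the remaining one. -/
  | classical {x y z : Crossing} (hx : x ≠ .virt) (hy : y ≠ .virt) (hz : z ≠ .virt)
      (h₁ : ¬ (x = .over ∧ y = .under ∧ z = .over))
      (h₂ : ¬ (x = .under ∧ y = .over ∧ z = .under)) : TriangleMove x y z
  /-- The virtual move VR3. -/
  | virtual : TriangleMove .virt .virt .virt
  /-- The mixed move MR: a strand with two virtual crossings passes the crossing of the other two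
  strands. -/
  | mixed_first (z : Crossing) : TriangleMove .virt .virt z
  | mixed_second (y : Crossing) : TriangleMove .virt y .virt
  | mixed_third (x : Crossing) : TriangleMove x .virt .virt

/-- The local moves.  The first five are planar isotopies, the others are the generalized
Reidemeister moves (R1 and VR1, R2 and VR2, R3 and VR3 and MR). -/
inductive LocalMove : List Event → List Event → Prop
  /-- Two events on disjoint sets of strands are exchanged. -/
  | exchange (a b : Piece) (p r : ℕ) :
      LocalMove [⟨a, p⟩, ⟨b, p + a.out + r⟩] [⟨b, p + a.inn + r⟩, ⟨a, p⟩]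
  /-- A zigzag is straightened. -/
  | zigzag_up (p : ℕ) : LocalMove [birth p, death (p + 1)] []
  | zigzag_down (p : ℕ) : LocalMove [birth (p + 1), death p] []
  /-- A left-most or right-most point of one strand is pulled across another strand that it
  crosses there, so that the crossing is now on the other one of its two branches. -/
  | slide_birth (c : Crossing) (p : ℕ) :
      LocalMove [birth (p + 1), cross c p] [birth p, cross c.flip (p + 1)]
  | slide_death (c : Crossing) (p : ℕ) :
      LocalMove [cross c p, death (p + 1)] [cross c.flip (p + 1), death p]
  /-- R1 and VR1: a kink is removed. -/
  | kink_birth (c : Crossing) (p : ℕ) : LocalMove [birth p, cross c p] [birth p]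
  | kink_death (c : Crossing) (p : ℕ) : LocalMove [cross c p, death p] [death p]
  /-- R2 and VR2. -/
  | bigon (c : Crossing) (p : ℕ) : LocalMove [cross c p, cross c.flip p] []
  /-- R3, VR3 and MR. -/
  | triangle {x y z : Crossing} (h : TriangleMove x y z) (p : ℕ) :
      LocalMove [cross x p, cross y (p + 1), cross z p]
        [cross z (p + 1), cross y p, cross x (p + 1)]

/-- One local move is applied somewhere in the diagram. -/
def Diagram.Move (D D' : Diagram) : Prop :=
  ∃ u v l r : List Event, LocalMove l r ∧ D.word = u ++ l ++ v ∧ D'.word = u ++ r ++ v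

/-- Two diagrams are equivalent (represent the same virtual link) if they are related by planar
isotopy and generalized Reidemeister moves. -/
def Diagram.Equivalent : Diagram → Diagram → Prop :=
  Relation.EqvGen Diagram.Move

/-- `D'` results from `D` by one crossing change, which is made at a classical crossing. -/
def Diagram.CrossingChange (D D' : Diagram) : Prop :=
  ∃ (u v : List Event) (c : Crossing) (p : ℕ), c ≠ .virt ∧
    D.word = u ++ [cross c p] ++ v ∧ D'.word = u ++ [cross c.flip p] ++ v

/-- The circle without crossings. -/
def unknot : Diagram := ⟨[birth 0, death 0], rfl⟩

/-- The diagram can be modified into the unknot by generalized Reidemeister moves and crossing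
changes. -/
def Diagram.VirtuallyNullHomotopic (D : Diagram) : Prop :=
  Relation.EqvGen (fun E E' : Diagram => E.Move E' ∨ E.CrossingChange E') D unknot

/-- `UnknottedBy n D`: the virtual link of `D` can be modified into the unknot by `n` crossing
changes, where the diagram may be replaced by an equivalent one before each crossing change and
after the last one. -/
inductive UnknottedBy : ℕ → Diagram → Prop
  | zero {D : Diagram} (h : D.Equivalent unknot) : UnknottedBy 0 D
  | succ {n : ℕ} {D E F : Diagram} (h₁ : D.Equivalent E) (h₂ : E.CrossingChange F)
      (h₃ : UnknottedBy n F) : UnknottedBy (n + 1) D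

/-- The virtual unknotting number: the minimal number of crossing changes that are needed to modify
the virtual knot into the unknot (meaningful if it is virtually null-homotopic). -/
noncomputable def virtualUnknottingNumber (D : Diagram) : ℕ :=
  sInf {n | UnknottedBy n D}

/-! ### Virtual braids and their closures -/

/-- A virtual braid diagram on `n` strands, as a word that is read from the left to the right.
The letter `(c, m)` is a crossing of the strands `m` and `m + 1`, where the strands are
counted from the top, beginning with `0`; `(.over, m)` is the generator `σ_{m+1}`. -/
structure VirtualBraid (n : ℕ) where
  word : List (Crossing × ℕ)
  valid : ∀ x ∈ word, x.2 + 1 < n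

/-- The product of two virtual braid diagrams: the first one, followed by the second one. -/
def VirtualBraid.mul {n : ℕ} (a b : VirtualBraid n) : VirtualBraid n where
  word := a.word ++ b.word
  valid := fun x hx => (List.mem_append.1 hx).elim (a.valid x) (b.valid x)

/-- The word of the closure of a braid word on `n` strands.  The `n` returning strands are drawn
above the braid, so the strand `m` of the braid is the strand `n + m` of the diagram. -/
def closureWord (n : ℕ) (w : List (Crossing × ℕ)) : List Event :=
  (List.range n).map birth ++ w.map (fun x => cross x.1 (n + x.2)) ++
    (List.range n).reverse.map death

theorem run_append (u v : List Event) (n : ℕ) :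
    run n (u ++ v) = (run n u).bind (fun m => run m v) := by
  induction u generalizing n with
  | nil => rfl
  | cons e u ih =>
    simp only [List.cons_append, run]
    split
    · exact ih _
    · rfl

theorem run_births (n : ℕ) : run 0 ((List.range n).map birth) = some (2 * n) := by
  induction n with
  | zero => rfl
  | succ n ih =>
    rw [List.range_succ, List.map_append, run_append, ih]
    simp [run, birth, Piece.inn, Piece.out]
    omega

theorem run_deaths (n : ℕ) : run (2 * n) ((List.range n).reverse.map death) = some 0 := by
  induction n with
  | zero => rfl
  | succ n ih =>
    rw [List.range_succ, List.reverse_append, List.reverse_singleton, List.singleton_append,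
      List.map_cons]
    have h : n + 2 ≤ 2 * (n + 1) := by omega
    have h' : 2 * (n + 1) - 2 + 0 = 2 * n := by omega
    simp only [run, death, Piece.inn, Piece.out, h, if_true, h']
    exact ih

theorem run_braid (n : ℕ) (w : List (Crossing × ℕ)) (hw : ∀ x ∈ w, x.2 + 1 < n) :
    run (2 * n) (w.map (fun x => cross x.1 (n + x.2))) = some (2 * n) := by
  induction w with
  | nil => rfl
  | cons x w ih =>
    have hx := hw x List.mem_cons_self
    have h : n + x.2 + 2 ≤ 2 * n := by omega
    have h' : 2 * n - 2 + 2 = 2 * n := by omega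
    simp only [List.map_cons, run, cross, Piece.inn, Piece.out, h, if_true, h']
    exact ih (fun y hy => hw y (List.mem_cons_of_mem _ hy))

/-- The closure of a virtual braid diagram. -/
def VirtualBraid.closure {n : ℕ} (b : VirtualBraid n) : Diagram where
  word := closureWord n b.word
  closed := by
    simp only [closureWord, run_append, run_births, run_braid n b.word b.valid,
      Option.bind_some, run_deaths]

/-! ### The virtual links `(i, j, k)` -/

/-- One strand runs from the top to the bottom of the braid and has a crossing of type `c` with
each of the other `n - 1` strands.  For `c = .over` it is an overstrand, `σ_1 σ_2 ⋯ σ_{n-1}`. -/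
def sweep (n : ℕ) (c : Crossing) : List (Crossing × ℕ) :=
  (List.range (n - 1)).map (fun m => (c, m))

/-- The braid part `(σ_1 σ_2 ⋯ σ_{i-1})^j` of the standard diagram of the `(i, j)`-torus link with
all crossings on the first one of its `j` overstrands turned into virtual crossings. -/
def VB (i j : ℕ) : VirtualBraid i where
  word := sweep i .virt ++ (List.replicate (j - 1) (sweep i .over)).flatten
  valid := by
    have h : ∀ (c : Crossing), ∀ x ∈ sweep i c, x.2 + 1 < i := by
      intro c x hx
      obtain ⟨m, hm, rfl⟩ := List.mem_map.1 hx
      have := List.mem_range.1 hm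
      show m + 1 < i
      omega
    intro x hx
    rcases List.mem_append.1 hx with hx | hx
    · exact h _ x hx
    · obtain ⟨l, hl, hx⟩ := List.mem_flatten.1 hx
      rw [List.eq_of_mem_replicate hl] at hx
      exact h _ x hx

/-- The braid `B_k = σ_k σ_{k-1} ⋯ σ_1` on `i` strands. -/
def B (i k : ℕ) (hk : k < i) : VirtualBraid i where
  word := (List.range k).reverse.map (fun m => (.over, m))
  valid := by
    intro x hx
    obtain ⟨m, hm, rfl⟩ := List.mem_map.1 hx
    have := List.mem_range.1 (List.mem_reverse.1 hm)
    show m + 1 < i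
    omega

/-- The virtual link diagram `(i, j, k)`: the closure of the product of `VB i j` and `B_k`. -/
def torusDiagram (i j k : ℕ) (hk : k < i) : Diagram :=
  ((VB i j).mul (B i k hk)).closure

end VirtualKnot

/-! The number `(i-1)(j-1)+k` counts the classical crossings of the diagram, all of them positive.
The proof bounds `vu` from both sides by half of it.

Lower bound: orient the diagram and put integers on its arcs that change by one at classical
crossings and not at virtual ones. The difference of the integers at a classical crossing determines
an index. The sum of the signs of the crossings with non-zero index is invariant under all
generalized Reidemeister moves (`eval_localMove`), vanishes on the unknot and changes by at most two
under a crossing change (`eval_crossingChange`). Compared with the integers of a classical braid,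
the strands of `(i, j, k)` carry an excess `h`, which only the virtual sweep alters. As the braid
permutation is a single cycle, the values of `h` are pairwise different (`exists_height`). So every
classical crossing has non-zero index and the invariant is the number of classical crossings
(`exists_labels`).

Upper bound: write the braid as a virtual sweep followed by a positive word. A crossing change turns
a square of a generator into a cancelling pair. Modulo such cancellations, every positive word
becomes a word that avoids the last strand, followed by one descent (`exists_reduces`). The first
factor passes through the virtual sweep and moves down by one strand. Connectedness keeps the
descent away from the top strand, which then meets only one virtual crossing and can be removed. A
shorter word of the same kind remains. By induction (`exists_unknotsIn`) one reaches the unknot, and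
each crossing change has used up exactly two letters. -/

namespace VirtualKnot

/-! ### Colourings of diagrams and their weights -/

/-- A way to colour the strands of a diagram and to weigh its crossings: `bar` is the colour of the
other branch at a left-most or right-most point, `cr c x y` are the colours, from the top, to the
right of a crossing of type `c` with colours `x`, `y` on the left, and `wt c x y` is its weight. -/
structure Palette (α : Type*) where
  bar : α → α
  cr : Crossing → α → α → α × α
  wt : Crossing → α → α → ℤ

namespace Palette

variable {α : Type*} (P : Palette α)

/-- The colours to the right of a crossing of the strands `p` and `p + 1`. -/
def crossAt (c : Crossing) (p : ℕ) (s : ℕ → α) : ℕ → α := fun q =>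
  if q = p then (P.cr c (s p) (s (p + 1))).1
  else if q = p + 1 then (P.cr c (s p) (s (p + 1))).2 else s q

/-- The colours to the right of a birth below `p` strands. -/
def birthAt (p : ℕ) (x : α) (s : ℕ → α) : ℕ → α := fun q =>
  if q < p then s q else if q = p then x else if q = p + 1 then P.bar x else s (q - 2)

/-- The colours to the right of a death of the strands `p` and `p + 1`. -/
def deathAt (p : ℕ) (s : ℕ → α) : ℕ → α := fun q => if q < p then s q else s (q + 2)

theorem crossAt_self (c : Crossing) (p : ℕ) (s : ℕ → α) :
    P.crossAt c p s p = (P.cr c (s p) (s (p + 1))).1 := by simp [crossAt]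

theorem crossAt_succ (c : Crossing) (p : ℕ) (s : ℕ → α) :
    P.crossAt c p s (p + 1) = (P.cr c (s p) (s (p + 1))).2 := by simp [crossAt]

theorem crossAt_succ_self (c : Crossing) (p : ℕ) (s : ℕ → α) :
    P.crossAt c (p + 1) s p = s p := by simp only [crossAt]; grind

theorem crossAt_add_two (c : Crossing) (p : ℕ) (s : ℕ → α) :
    P.crossAt c p s (p + 1 + 1) = s (p + 1 + 1) := by simp only [crossAt]; grind

/-- The word has a colouring of total weight `n` with the colours `s` on the left and `z` on the
right. -/
def Eval (z : ℕ → α) : List Event → (ℕ → α) → ℤ → Prop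
  | [], s, n => s = z ∧ n = 0
  | ⟨.birth, p⟩ :: w, s, n => ∃ x, Eval z w (P.birthAt p x s) n
  | ⟨.death, p⟩ :: w, s, n => s (p + 1) = P.bar (s p) ∧ Eval z w (deathAt p s) n
  | ⟨.cross c, p⟩ :: w, s, n => Eval z w (P.crossAt c p s) (n - P.wt c (s p) (s (p + 1)))

theorem eval_prefix {z : ℕ → α} {w w' : List Event}
    (h : ∀ s n, P.Eval z w s n ↔ P.Eval z w' s n) (u : List Event) (s : ℕ → α) (n : ℤ) :
    P.Eval z (u ++ w) s n ↔ P.Eval z (u ++ w') s n := by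
  induction u generalizing s n with
  | nil => exact h s n
  | cons e u ih =>
    obtain ⟨_ | _ | c, p⟩ := e <;> simp [Eval, ih]

/-- Events on disjoint strands read and write disjoint sets of colours, so this holds for every
palette. -/
theorem eval_exchange (z : ℕ → α) (a b : Piece) (p r : ℕ) (w : List Event) (s : ℕ → α) (n : ℤ) :
    P.Eval z (⟨a, p⟩ :: ⟨b, p + a.out + r⟩ :: w) s n ↔
      P.Eval z (⟨b, p + a.inn + r⟩ :: ⟨a, p⟩ :: w) s n := by
  rcases a with _ | _ | c <;> rcases b with _ | _ | d <;>
    simp only [Eval, Piece.inn, Piece.out]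
  · rw [exists_comm]
    refine exists_congr fun x => exists_congr fun y => ?_
    rw [show P.birthAt (p + 2 + r) x (P.birthAt p y s) = P.birthAt p y (P.birthAt (p + 0 + r) x s)
      by funext q; simp only [birthAt]; grind (splits := 20)]
  · rw [← exists_and_left]
    refine exists_congr fun x => ?_
    rw [show deathAt (p + 2 + r) (P.birthAt p x s) = P.birthAt p x (deathAt (p + 0 + r) s)
      by funext q; simp only [birthAt, deathAt]; grind]
    rw [show P.birthAt p x s (p + 2 + r + 1) = s (p + 0 + r + 1) by simp only [birthAt]; grind,
      show P.birthAt p x s (p + 2 + r) = s (p + 0 + r) by simp only [birthAt]; grind]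
  · refine exists_congr fun x => ?_
    rw [show P.crossAt d (p + 2 + r) (P.birthAt p x s) = P.birthAt p x (P.crossAt d (p + 0 + r) s)
      by funext q; simp only [birthAt, crossAt]; grind]
    rw [show P.birthAt p x s (p + 2 + r + 1) = s (p + 0 + r + 1) by simp only [birthAt]; grind,
      show P.birthAt p x s (p + 2 + r) = s (p + 0 + r) by simp only [birthAt]; grind]
  · rw [← exists_and_left]
    refine exists_congr fun x => ?_
    rw [show P.birthAt (p + 0 + r) x (deathAt p s) = deathAt p (P.birthAt (p + 2 + r) x s)
      by funext q; simp only [birthAt, deathAt]; grind]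
    rw [show P.birthAt (p + 2 + r) x s (p + 1) = s (p + 1) by simp only [birthAt]; grind,
      show P.birthAt (p + 2 + r) x s p = s p by simp only [birthAt]; grind]
  · rw [show deathAt (p + 0 + r) (deathAt p s) = deathAt p (deathAt (p + 2 + r) s)
      by funext q; simp only [deathAt]; grind]
    simp only [deathAt]
    grind
  · rw [show P.crossAt d (p + 0 + r) (deathAt p s) = deathAt p (P.crossAt d (p + 2 + r) s)
      by funext q; simp only [crossAt, deathAt]; grind]
    simp only [deathAt, crossAt]
    grind
  · refine exists_congr fun x => ?_
    rw [show P.birthAt (p + 2 + r) x (P.crossAt c p s) = P.crossAt c p (P.birthAt (p + 2 + r) x s)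
      by funext q; simp only [birthAt, crossAt]; grind]
    rw [show P.birthAt (p + 2 + r) x s (p + 1) = s (p + 1) by simp only [birthAt]; grind,
      show P.birthAt (p + 2 + r) x s p = s p by simp only [birthAt]; grind]
  · rw [show deathAt (p + 2 + r) (P.crossAt c p s) = P.crossAt c p (deathAt (p + 2 + r) s)
      by funext q; simp only [crossAt, deathAt]; grind]
    simp only [deathAt, crossAt]
    grind
  · rw [show P.crossAt d (p + 2 + r) (P.crossAt c p s) = P.crossAt c p (P.crossAt d (p + 2 + r) s)
      by funext q; simp only [crossAt]; grind]
    rw [show P.crossAt c p s (p + 2 + r) = s (p + 2 + r) by simp only [crossAt]; grind,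
      show P.crossAt c p s (p + 2 + r + 1) = s (p + 2 + r + 1) by simp only [crossAt]; grind,
      show P.crossAt d (p + 2 + r) s p = s p by simp only [crossAt]; grind,
      show P.crossAt d (p + 2 + r) s (p + 1) = s (p + 1) by simp only [crossAt]; grind,
      sub_right_comm]

end Palette

/-! ### The index invariant -/

/-- `0` for virtual crossings; otherwise `1` or `-1`, the sign of the crossing if both strands are
oriented to the right. -/
def Crossing.sign : Crossing → ℤ
  | .over => 1
  | .under => -1
  | .virt => 0

/-- The colours are an orientation (`1` for right) and an integer, which changes by one at the
classical crossings.  The weight of a crossing is its sign, or zero if the crossing has index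
zero. -/
def affinePalette : Palette (ℤˣ × ℤ) where
  bar x := (-x.1, x.2)
  cr c x y := ((y.1, y.2 + c.sign ^ 2 * x.1), (x.1, x.2 - c.sign ^ 2 * y.1))
  wt c x y := if 2 * (x.2 - y.2) = x.1 + y.1 then 0 else c.sign * x.1 * y.1

open Palette

theorem Crossing.sign_flip (c : Crossing) : c.flip.sign = -c.sign := by cases c <;> rfl

/-- The colours see only the square of the sign. So a colouring survives a crossing change, and only
the weight of that crossing is negated. -/
theorem crossAt_flip (c : Crossing) (p : ℕ) :
    affinePalette.crossAt c.flip p = affinePalette.crossAt c p := by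
  funext s q
  simp [crossAt, affinePalette, Crossing.sign_flip]

theorem wt_flip (c : Crossing) (x y : ℤˣ × ℤ) :
    affinePalette.wt c.flip x y = -affinePalette.wt c x y := by
  simp only [affinePalette, Crossing.sign_flip]
  split_ifs <;> ring

/-- The colours outside the move determine those inside, up to a bijective choice at a birth. Kinks
weigh nothing because their crossing has index zero; the two crossings of a bigon have equal index
and opposite signs; in a triangle each classical crossing sees the same difference of integers
before and after the move. -/
theorem eval_localMove {l r : List Event} (h : LocalMove l r) (z : ℕ → ℤˣ × ℤ) (w : List Event)
    (s : ℕ → ℤˣ × ℤ) (n : ℤ) :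
    affinePalette.Eval z (l ++ w) s n ↔ affinePalette.Eval z (r ++ w) s n := by
  cases h with
  | exchange a b p r => exact eval_exchange _ z a b p r w s n
  | zigzag_up p =>
    simp only [birth, death, List.cons_append, List.nil_append, Eval]
    have key (x) : affinePalette.birthAt p x s (p + 1 + 1) =
        affinePalette.bar (affinePalette.birthAt p x s (p + 1)) ↔ x = s p := by
      have h1 : affinePalette.birthAt p x s (p + 1 + 1) = s p := by simp only [birthAt]; grind
      have h2 : affinePalette.birthAt p x s (p + 1) = affinePalette.bar x := by
        simp only [birthAt]; grind
      rw [h1, h2, eq_comm]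
      simp [affinePalette]
    have h2 : deathAt (p + 1) (affinePalette.birthAt p (s p) s) = s := by
      funext q; simp only [birthAt, deathAt]; grind
    simp [key, h2]
  | zigzag_down p =>
    simp only [birth, death, List.cons_append, List.nil_append, Eval]
    have key (x) : affinePalette.birthAt (p + 1) x s (p + 1) =
        affinePalette.bar (affinePalette.birthAt (p + 1) x s p) ↔ x = affinePalette.bar (s p) := by
      simp [birthAt, affinePalette]
    have h2 : deathAt p (affinePalette.birthAt (p + 1) (affinePalette.bar (s p)) s) = s := by
      funext q
      rcases lt_trichotomy q p with h | h | h
      · simp only [birthAt, deathAt]; grind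
      · subst h
        simp [birthAt, deathAt, affinePalette]
      · simp only [birthAt, deathAt]; grind
    simp [key, h2]
  | slide_birth c p =>
    simp only [birth, cross, List.cons_append, List.nil_append, Eval]
    -- The left-most point now lies on the other side of strand `p`, so its integer is shifted as by
    -- a passage under or over that strand.
    have key (o : ℤˣ) (a : ℤ) : affinePalette.crossAt c p (affinePalette.birthAt (p + 1) (o, a) s) =
        affinePalette.crossAt c.flip (p + 1)
          (affinePalette.birthAt p (o, a + c.sign ^ 2 * (s p).1) s) := by
      rw [crossAt_flip]
      funext q
      simp only [birthAt, crossAt, affinePalette]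
      grind (splits := 25) [Units.val_neg]
    have key' (o : ℤˣ) (a : ℤ) :
        affinePalette.wt c (affinePalette.birthAt (p + 1) (o, a) s p)
          (affinePalette.birthAt (p + 1) (o, a) s (p + 1)) =
        affinePalette.wt c.flip
          (affinePalette.birthAt p (o, a + c.sign ^ 2 * (s p).1) s (p + 1))
          (affinePalette.birthAt p (o, a + c.sign ^ 2 * (s p).1) s (p + 1 + 1)) := by
      have h1 : affinePalette.birthAt (p + 1) (o, a) s p = s p := by simp only [birthAt]; grind
      have h2 : affinePalette.birthAt (p + 1) (o, a) s (p + 1) = (o, a) := by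
        simp only [birthAt]; grind
      have h3 (x) : affinePalette.birthAt p x s (p + 1) = affinePalette.bar x := by
        simp only [birthAt]; grind
      have h4 (x) : affinePalette.birthAt p x s (p + 1 + 1) = s p := by simp only [birthAt]; grind
      rw [h1, h2, h3, h4]
      rcases c <;> simp only [affinePalette, Crossing.sign, Crossing.flip] <;> push_cast <;> grind
    constructor
    · rintro ⟨⟨o, a⟩, h⟩
      rw [key, key'] at h
      exact ⟨_, h⟩
    · rintro ⟨⟨o, a⟩, h⟩
      refine ⟨(o, a - c.sign ^ 2 * (s p).1), ?_⟩
      rw [key, key']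
      simpa using h
  | slide_death c p =>
    simp only [death, cross, List.cons_append, List.nil_append, Eval, crossAt_flip, wt_flip]
    have h1 : affinePalette.crossAt c p s (p + 1 + 1) =
        affinePalette.bar (affinePalette.crossAt c p s (p + 1)) ↔
        (s (p + 2)).1 = -(s p).1 ∧ (s (p + 2)).2 = (s p).2 - c.sign ^ 2 * (s (p + 1)).1 := by
      rw [crossAt_add_two, crossAt_succ]
      simp [affinePalette, Prod.ext_iff]
    have h2 : affinePalette.crossAt c (p + 1) s (p + 1) =
        affinePalette.bar (affinePalette.crossAt c (p + 1) s p) ↔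
        (s (p + 2)).1 = -(s p).1 ∧ (s (p + 2)).2 = (s p).2 - c.sign ^ 2 * (s (p + 1)).1 := by
      rw [crossAt_self, crossAt_succ_self]
      simp [affinePalette, Prod.ext_iff, eq_sub_iff_add_eq]
    rw [h1, h2]
    refine and_congr_right fun ⟨h3, h4⟩ => ?_
    have h5 : deathAt (p + 1) (affinePalette.crossAt c p s) =
        deathAt p (affinePalette.crossAt c (p + 1) s) := by
      funext q
      have h6 : ((s (p + 2)).1 : ℤ) = -(s p).1 := by rw [h3, Units.val_neg]
      simp only [deathAt, crossAt, affinePalette]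
      grind (splits := 25)
    have h6 : affinePalette.wt c (s p) (s (p + 1)) =
        -affinePalette.wt c (s (p + 1)) (s (p + 1 + 1)) := by
      simp only [affinePalette, h3, h4, Units.val_neg]
      rcases c <;> simp only [Crossing.sign] <;> grind
    rw [h5, h6]
  | kink_birth c p =>
    simp only [birth, cross, List.cons_append, List.nil_append, Eval]
    have key (o : ℤˣ) (a : ℤ) : affinePalette.crossAt c p (affinePalette.birthAt p (o, a) s) =
          affinePalette.birthAt p (-o, a + c.sign ^ 2 * o) s := by
      funext q
      simp only [birthAt, crossAt, affinePalette]
      rcases c <;> simp only [Crossing.sign] <;> grind (splits := 25) [Units.val_neg, neg_neg]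
    have key' (x) : affinePalette.wt c (affinePalette.birthAt p x s p)
          (affinePalette.birthAt p x s (p + 1)) = 0 := by
      simp [birthAt, affinePalette]
    constructor
    · rintro ⟨⟨o, a⟩, h⟩
      rw [key, key', sub_zero] at h
      exact ⟨_, h⟩
    · rintro ⟨⟨o, a⟩, h⟩
      refine ⟨(-o, a + c.sign ^ 2 * o), ?_⟩
      rw [key, key']
      simpa using h
  | kink_death c p =>
    simp only [death, cross, List.cons_append, List.nil_append, Eval]
    have h1 : affinePalette.crossAt c p s (p + 1) =
        affinePalette.bar (affinePalette.crossAt c p s p) ↔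
        s (p + 1) = affinePalette.bar (s p) := by
      have h6 : (s p).1 = -(s (p + 1)).1 → ((s p).1 : ℤ) = -(s (p + 1)).1 := by
        intro h; rw [h, Units.val_neg]
      have h7 : (s p).1 = -(s (p + 1)).1 ↔ (s (p + 1)).1 = -(s p).1 :=
        ⟨fun h => by rw [h, neg_neg], fun h => by rw [h, neg_neg]⟩
      simp only [crossAt, affinePalette, Prod.ext_iff]
      grind
    rw [h1]
    refine and_congr_right fun h3 => ?_
    have h5 : deathAt p (affinePalette.crossAt c p s) = deathAt p s := by
      funext q
      simp only [deathAt, crossAt]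
      grind
    have h6 : affinePalette.wt c (s p) (s (p + 1)) = 0 := by
      simp [affinePalette, h3]
    rw [h5, h6, sub_zero]
  | bigon c p =>
    simp only [cross, List.cons_append, List.nil_append, Eval]
    rw [show affinePalette.crossAt c.flip p (affinePalette.crossAt c p s) = s by
      rw [crossAt_flip]
      funext q
      simp only [crossAt, affinePalette]
      grind]
    have h : affinePalette.wt c.flip (affinePalette.crossAt c p s p)
        (affinePalette.crossAt c p s (p + 1)) = - affinePalette.wt c (s p) (s (p + 1)) := by
      rw [wt_flip]
      rcases c <;> simp [crossAt, affinePalette, Crossing.sign] <;> grind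
    rw [h]
    simp
  | @triangle x y z h p =>
    simp only [cross, List.cons_append, List.nil_append, Eval]
    have h1 : affinePalette.crossAt z p (affinePalette.crossAt y (p + 1)
          (affinePalette.crossAt x p s)) =
        affinePalette.crossAt x (p + 1) (affinePalette.crossAt y p
          (affinePalette.crossAt z (p + 1) s)) := by
      funext q
      simp only [crossAt, affinePalette]
      grind (splits := 25)
    rw [h1, sub_sub, sub_sub, sub_sub, sub_sub]
    refine iff_of_eq (congrArg (fun m => affinePalette.Eval _ w _ (n - m)) ?_)
    simp only [crossAt_self, crossAt_succ, crossAt_succ_self, crossAt_add_two]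
    generalize s p = A
    generalize s (p + 1) = B
    generalize s (p + 1 + 1) = C
    simp only [affinePalette]
    cases h with
    | classical hx hy hz _ _ =>
      have e {c : Crossing} (hc : c ≠ .virt) : c.sign ^ 2 = 1 := by
        cases c <;> simp [Crossing.sign] at hc ⊢
      rw [e hx, e hy, e hz]
      grind
    | virtual => simp [Crossing.sign]
    | mixed_first => simp [Crossing.sign]
    | mixed_second => simp [Crossing.sign]
    | mixed_third => simp [Crossing.sign]

/-- The colour of the strands that are not there. -/
def background : ℕ → ℤˣ × ℤ := fun _ => (1, 0)

/-- The invariant is the set of weights of all colourings, so no colouring has to be singled out. -/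
theorem Diagram.Equivalent.eval_iff {D E : Diagram} (h : D.Equivalent E) (n : ℤ) :
    affinePalette.Eval background D.word background n ↔
      affinePalette.Eval background E.word background n := by
  induction h with
  | rel D E h =>
    obtain ⟨u, v, l, r, h, hD, hE⟩ := h
    rw [hD, hE, List.append_assoc, List.append_assoc]
    exact eval_prefix _ (eval_localMove h _ v) u _ n
  | refl => rfl
  | symm _ _ _ ih => exact ih.symm
  | trans _ _ _ _ _ ih₁ ih₂ => exact ih₁.trans ih₂

/-! ### Crossing changes and the lower bound -/

theorem abs_wt_le_one (c : Crossing) (x y : ℤˣ × ℤ) : |affinePalette.wt c x y| ≤ 1 := by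
  simp only [affinePalette]
  split_ifs
  · simp
  · rw [abs_mul, abs_mul]
    have h (u : ℤˣ) : |(u : ℤ)| = 1 := by rcases Int.units_eq_one_or u with rfl | rfl <;> simp
    rw [h, h]
    cases c <;> simp [Crossing.sign]

theorem eval_crossingChange {z : ℕ → ℤˣ × ℤ} (u v : List Event) (c : Crossing) (p : ℕ)
    {s : ℕ → ℤˣ × ℤ} {n : ℤ} (h : affinePalette.Eval z (u ++ cross c p :: v) s n) :
    ∃ m, |n - m| ≤ 2 ∧ affinePalette.Eval z (u ++ cross c.flip p :: v) s m := by
  induction u generalizing s n with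
  | nil =>
    -- The same colouring is kept; one weight in `{-1, 0, 1}` changes its sign.
    refine ⟨n - 2 * affinePalette.wt c (s p) (s (p + 1)), ?_, ?_⟩
    · have := abs_wt_le_one c (s p) (s (p + 1))
      rw [sub_sub_cancel, abs_mul]
      norm_num
      linarith
    · simp only [List.nil_append, cross, Eval] at h ⊢
      rw [crossAt_flip, wt_flip]
      convert h using 1
      ring
  | cons e u ih =>
    obtain ⟨_ | _ | d, q⟩ := e <;> simp only [List.cons_append, Eval] at h ⊢
    · obtain ⟨x, h⟩ := h
      obtain ⟨m, hm, h⟩ := ih h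
      exact ⟨m, hm, x, h⟩
    · obtain ⟨m, hm, h'⟩ := ih h.2
      exact ⟨m, hm, h.1, h'⟩
    · obtain ⟨m, hm, h⟩ := ih h
      refine ⟨m + affinePalette.wt d (s q) (s (q + 1)), ?_, by simpa using h⟩
      convert hm using 2
      ring

theorem UnknottedBy.abs_le {m : ℕ} {D : Diagram} (h : UnknottedBy m D) {n : ℤ}
    (hn : affinePalette.Eval background D.word background n) : |n| ≤ 2 * m := by
  induction h generalizing n with
  | zero h =>
    rw [h.eval_iff] at hn
    obtain ⟨_, _, _, rfl⟩ := hn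
    simp
  | @succ m D E F h₁ h₂ _ ih =>
    rw [h₁.eval_iff] at hn
    obtain ⟨u, v, c, p, _, hE, hF⟩ := h₂
    rw [hE, List.append_assoc] at hn
    obtain ⟨k, hk, hn⟩ := eval_crossingChange u v c p hn
    have := ih (by rw [hF, List.append_assoc]; exact hn)
    have h3 := abs_add_le (n - k) k
    rw [sub_add_cancel] at h3
    push_cast
    linarith

theorem Diagram.Equivalent.virtuallyHomotopic {D E : Diagram} (h : D.Equivalent E) :
    Relation.EqvGen (fun E E' : Diagram => E.Move E' ∨ E.CrossingChange E') D E := by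
  induction h with
  | rel D E h => exact .rel _ _ (Or.inl h)
  | refl => exact .refl _
  | symm _ _ _ ih => exact ih.symm
  | trans _ _ _ _ _ ih₁ ih₂ => exact ih₁.trans _ _ _ ih₂

theorem UnknottedBy.virtuallyNullHomotopic {m : ℕ} {D : Diagram} (h : UnknottedBy m D) :
    D.VirtuallyNullHomotopic := by
  induction h with
  | zero h => exact h.virtuallyHomotopic
  | succ h₁ h₂ _ ih =>
    exact h₁.virtuallyHomotopic.trans _ _ _
      (.trans _ _ _ (.rel _ _ (Or.inr h₂)) ih)

theorem UnknottedBy.of_equivalent {m : ℕ} {D E : Diagram} (h : D.Equivalent E)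
    (hE : UnknottedBy m E) : UnknottedBy m D := by
  cases hE with
  | zero h' => exact .zero (h.trans _ _ _ h')
  | succ h₁ h₂ h₃ => exact .succ (h.trans _ _ _ h₁) h₂ h₃

/-! ### Colourings of closed braids -/

namespace Palette

variable {α : Type*} (P : Palette α)

/-- The colours to the right of a braid word. -/
def act : List (Crossing × ℕ) → (ℕ → α) → ℕ → α
  | [], s => s
  | x :: w, s => act w (P.crossAt x.1 x.2 s)

/-- The sum of the weights of the crossings of a braid word. -/
def weight : List (Crossing × ℕ) → (ℕ → α) → ℤ
  | [], _ => 0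
  | x :: w, s => P.wt x.1 (s x.2) (s (x.2 + 1)) + weight w (P.crossAt x.1 x.2 s)

theorem act_append (u v : List (Crossing × ℕ)) (s : ℕ → α) :
    P.act (u ++ v) s = P.act v (P.act u s) := by
  induction u generalizing s with
  | nil => rfl
  | cons x u ih => exact ih _

theorem weight_append (u v : List (Crossing × ℕ)) (s : ℕ → α) :
    P.weight (u ++ v) s = P.weight u s + P.weight v (P.act u s) := by
  induction u generalizing s with
  | nil => simp [weight, act]
  | cons x u ih => simp [weight, act, ih, add_assoc]

/-- The colours of a closed braid on `n` strands: `s` on the braid, the other branches of `r` on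
the returning strands above it, and `a` below. -/
def closureState (n : ℕ) (a : α) (r s : ℕ → α) : ℕ → α := fun q =>
  if q < n then P.bar (r (n - 1 - q)) else if q < 2 * n then s (q - n) else a

/-- The births are nested, and the last one opens the first strand of the braid. The offset `m` lets
the induction peel off this innermost arc. -/
theorem eval_births {z : ℕ → α} {w : List Event} {n m : ℕ} {a : α} {s : ℕ → α} {k : ℤ}
    (hbar : ∀ x, P.bar (P.bar x) = x)
    (h : P.Eval z w (P.closureState n a (fun q => s (m + q)) (fun q => s (m + q))) k) :
    P.Eval z ((List.range n).map birth ++ w) (fun _ => a) k := by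
  induction n generalizing w m with
  | zero =>
    have h' : P.closureState 0 a (fun q => s (m + q)) (fun q => s (m + q)) = fun _ => a := by
      funext q
      simp [closureState]
    rwa [h'] at h
  | succ n ih =>
    rw [List.range_succ, List.map_append, List.append_assoc]
    refine ih (m := m + 1) ?_
    -- The colour chosen at a birth is that of the upper branch, which is the returning strand.
    refine ⟨P.bar (s m), ?_⟩
    have h' : P.birthAt n (P.bar (s m)) (P.closureState n a (fun q => s (m + 1 + q)) fun q => s (m + 1 + q)) =
        P.closureState (n + 1) a (fun q => s (m + q)) fun q => s (m + q) := by
      funext q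
      simp only [birthAt, closureState, hbar]
      grind (splits := 20)
    show P.Eval z w _ k
    rwa [h']

theorem eval_deaths {n m : ℕ} {a : α} {s : ℕ → α} (hbar : ∀ x, P.bar (P.bar x) = x) :
    P.Eval (fun _ => a) ((List.range n).reverse.map death)
      (P.closureState n a (fun q => s (m + q)) (fun q => s (m + q))) 0 := by
  induction n generalizing m with
  | zero =>
    refine ⟨?_, rfl⟩
    funext q
    simp [closureState]
  | succ n ih =>
    rw [List.range_succ, List.reverse_append, List.reverse_singleton, List.singleton_append,
      List.map_cons]
    refine ⟨?_, ?_⟩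
    · simp only [closureState]
      grind
    · convert ih (m := m + 1) using 1
      funext q
      simp only [deathAt, closureState]
      grind (splits := 20)

theorem eval_braid {z : ℕ → α} {n : ℕ} {a : α} {r s : ℕ → α} {u : List (Crossing × ℕ)}
    {w : List Event} {k : ℤ} (hu : ∀ x ∈ u, x.2 + 1 < n)
    (h : P.Eval z w (P.closureState n a r (P.act u s)) k) :
    P.Eval z (u.map (fun x => cross x.1 (n + x.2)) ++ w) (P.closureState n a r s)
      (P.weight u s + k) := by
  induction u generalizing s k with
  | nil => simpa [weight, act] using h
  | cons x u ih =>
    have hx := hu x List.mem_cons_self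
    have h1 : P.crossAt x.1 (n + x.2) (P.closureState n a r s) =
        P.closureState n a r (P.crossAt x.1 x.2 s) := by
      funext q
      simp only [crossAt, closureState]
      grind (splits := 25)
    have h2 : P.closureState n a r s (n + x.2) = s x.2 := by
      simp only [closureState]; grind
    have h3 : P.closureState n a r s (n + x.2 + 1) = s (x.2 + 1) := by
      simp only [closureState]; grind
    show P.Eval z _ (P.crossAt x.1 (n + x.2) _) (_ - P.wt x.1 _ _)
    rw [h1, h2, h3]
    have h4 := ih (fun y hy => hu y (List.mem_cons_of_mem _ hy)) h
    rwa [show P.weight u (P.crossAt x.1 x.2 s) + k =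
      P.weight (x :: u) s + k - P.wt x.1 (s x.2) (s (x.2 + 1)) by simp only [weight]; ring] at h4

/-- Colours that the braid reproduces at its right end can be continued along the returning strands.
-/
theorem eval_closure {n : ℕ} (b : VirtualBraid n) {a : α} {s : ℕ → α}
    (hbar : ∀ x, P.bar (P.bar x) = x) (hs : ∀ q < n, P.act b.word s q = s q) :
    P.Eval (fun _ => a) b.closure.word (fun _ => a) (P.weight b.word s) := by
  have h := P.eval_braid (n := n) (a := a) (k := 0) (r := s) (s := s) b.valid (z := fun _ => a)
    (w := (List.range n).reverse.map death) ?_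
  · have h' := P.eval_births (m := 0) (s := s) hbar (by simpa only [zero_add] using h)
    rw [add_zero, ← List.append_assoc] at h'
    exact h'
  · have h' : P.closureState n a s (P.act b.word s) = P.closureState n a s s := by
      funext q
      simp only [closureState]
      grind
    rw [h']
    simpa only [zero_add] using P.eval_deaths (n := n) (m := 0) (a := a) (s := s) hbar

end Palette

/-! ### The permutation of a braid and connectedness of its closure -/

/-- The strand at place `q` at the end of the braid word starts at place `perm w q`. -/
def perm : List (Crossing × ℕ) → Equiv.Perm ℕ
  | [] => 1
  | x :: w => Equiv.swap x.2 (x.2 + 1) * perm w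

theorem perm_append (u v : List (Crossing × ℕ)) : perm (u ++ v) = perm u * perm v := by
  induction u with
  | nil => rfl
  | cons x u ih => simp [perm, ih, mul_assoc]

theorem perm_lt_iff {n : ℕ} {w : List (Crossing × ℕ)} (hw : ∀ x ∈ w, x.2 + 1 < n) (q : ℕ) :
    perm w q < n ↔ q < n := by
  induction w with
  | nil => rfl
  | cons x w ih =>
    have hx := hw x List.mem_cons_self
    rw [← ih fun y hy => hw y (List.mem_cons_of_mem _ hy)]
    simp only [perm, Equiv.Perm.mul_apply, Equiv.swap_apply_def]
    grind

/-- The closure of the braid word on `n` strands is connected: sets of strands that are invariant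
under its permutation are empty or everything. -/
def Conn (n : ℕ) (w : List (Crossing × ℕ)) : Prop :=
  ∀ s : ℕ → Prop, (∀ q < n, (s (perm w q) ↔ s q)) → ∀ q < n, (s q ↔ s 0)

/-- Colours that are constant along the strands. -/
def strandPalette (α : Type*) : Palette α where
  bar x := x
  cr _ x y := (y, x)
  wt _ _ _ := 0

theorem strandPalette_act {α : Type*} (w : List (Crossing × ℕ)) (s : ℕ → α) :
    (strandPalette α).act w s = s ∘ perm w := by
  induction w generalizing s with
  | nil => rfl
  | cons x w ih =>
    rw [act, ih, perm, Equiv.Perm.coe_mul, ← Function.comp_assoc]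
    congr 1
    funext q
    simp only [crossAt, strandPalette, Function.comp, Equiv.swap_apply_def]
    grind

section Points

variable {α : Type*}

/-- `F` is constant along the arcs of the word. -/
def ConstantOnArcs (w : List Event) (F : ℕ → ℕ → α) : Prop :=
  ∀ x y, Joined w x y → F x.1 x.2 = F y.1 y.2

/-- The colouring `F` of a word, preceded by the colours `s`. -/
def consState (s : ℕ → α) (F : ℕ → ℕ → α) : ℕ → ℕ → α
  | 0 => s
  | t + 1 => F t

theorem ConstantOnArcs.cons {w : List Event} {F : ℕ → ℕ → α} (h : ConstantOnArcs w F) {e : Event}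
    {s : ℕ → α} (habove : ∀ q < e.pos, s q = F 0 q)
    (hbelow : ∀ r, s (e.pos + e.piece.inn + r) = F 0 (e.pos + e.piece.out + r))
    (hbirth : e.piece = .birth → F 0 e.pos = F 0 (e.pos + 1))
    (hdeath : e.piece = .death → s e.pos = s (e.pos + 1))
    (hcross : ∀ c, e.piece = .cross c → s e.pos = F 0 (e.pos + 1) ∧ s (e.pos + 1) = F 0 e.pos) :
    ConstantOnArcs (e :: w) (consState s F) := by
  intro x y hxy
  cases hxy with
  | @above t e' h' p hp =>
    cases t with
    | zero => cases h'; exact habove p hp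
    | succ t => exact h _ _ (.above (w := w) (t := t) h' p hp)
  | @below t e' h' r =>
    cases t with
    | zero => cases h'; exact hbelow r
    | succ t => exact h _ _ (.below (w := w) (t := t) h' r)
  | @birth t p h' =>
    cases t with
    | zero => cases h'; exact hbirth rfl
    | succ t => exact h _ _ (.birth h')
  | @death t p h' =>
    cases t with
    | zero => cases h'; exact hdeath rfl
    | succ t => exact h _ _ (.death h')
  | @down t p c h' =>
    cases t with
    | zero => cases h'; exact (hcross _ rfl).1
    | succ t => exact h _ _ (.down h')
  | @up t p c h' =>
    cases t with
    | zero => cases h'; exact (hcross _ rfl).2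
    | succ t => exact h _ _ (.up h')

theorem exists_constantOnArcs {z : ℕ → α} {w : List Event} {s : ℕ → α} {n : ℤ}
    (h : (strandPalette α).Eval z w s n) :
    ∃ F : ℕ → ℕ → α, ConstantOnArcs w F ∧ F 0 = s := by
  induction w generalizing s n with
  | nil =>
    refine ⟨fun _ => s, ?_, rfl⟩
    rintro x y (⟨h', _⟩ | ⟨h', _⟩ | h' | h' | h' | h') <;> simp at h'
  | cons e w ih =>
    obtain ⟨_ | _ | c, p⟩ := e
    · obtain ⟨x, h⟩ := h
      obtain ⟨F, hF, h0⟩ := ih h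
      refine ⟨_, hF.cons (s := s) ?_ ?_ ?_ ?_ ?_, rfl⟩ <;>
        simp only [h0, birthAt, strandPalette, Piece.inn, Piece.out] <;> grind
    · obtain ⟨hx, h⟩ := h
      obtain ⟨F, hF, h0⟩ := ih h
      refine ⟨_, hF.cons (s := s) ?_ ?_ ?_ ?_ ?_, rfl⟩ <;>
        simp only [h0, deathAt, strandPalette, Piece.inn, Piece.out] at hx ⊢ <;> grind
    · obtain ⟨F, hF, h0⟩ := ih h
      refine ⟨_, hF.cons (s := s) ?_ ?_ ?_ ?_ ?_, rfl⟩ <;>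
        simp only [h0, crossAt, strandPalette, Piece.inn, Piece.out] <;> grind

theorem ConstantOnArcs.births {n m : ℕ} {a : α} {s : ℕ → α} {w : List Event} {F : ℕ → ℕ → α}
    (h : ConstantOnArcs w F)
    (h0 : F 0 = (strandPalette α).closureState n a (fun q => s (m + q)) (fun q => s (m + q))) :
    ∃ G : ℕ → ℕ → α, ConstantOnArcs ((List.range n).map birth ++ w) G ∧
      ∀ t, G (n + t) = F t := by
  induction n generalizing m w F with
  | zero => exact ⟨F, h, fun t => by rw [zero_add]⟩
  | succ n ih =>
    rw [List.range_succ, List.map_append, List.append_assoc]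
    have h1 : ConstantOnArcs (birth n :: w) (consState ((strandPalette α).closureState n a
        (fun q => s (m + 1 + q)) (fun q => s (m + 1 + q))) F) := by
      refine h.cons ?_ ?_ ?_ ?_ ?_ <;>
        simp only [h0, closureState, strandPalette, Piece.inn, Piece.out, birth] <;> grind
    obtain ⟨G, hG, hG'⟩ := ih h1 rfl
    exact ⟨G, hG, fun t => by rw [add_assoc, hG', add_comm 1 t]; rfl⟩

end Points

/-- An invariant predicate is a `Prop`-valued colouring of the closed braid that is constant along
arcs, hence constant if there is only one component. -/
theorem conn_of_isKnot {n : ℕ} (b : VirtualBraid n) (h : b.closure.IsKnot) : Conn n b.word := by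
  intro s hs q hq
  have hact : ∀ q < n, (strandPalette Prop).act b.word s q = s q := by
    intro q hq
    rw [strandPalette_act]
    exact propext (hs q hq)
  have h1 := (strandPalette Prop).eval_braid (n := n) (a := False) (k := 0) (r := s) (s := s)
    b.valid (z := fun _ => False) (w := (List.range n).reverse.map death) (by
      have h' : (strandPalette Prop).closureState n False s ((strandPalette Prop).act b.word s) =
          (strandPalette Prop).closureState n False s s := by
        funext q
        simp only [closureState]
        grind
      rw [h']
      simpa only [zero_add] using (strandPalette Prop).eval_deaths (n := n) (m := 0) (a := False)
        (s := s) fun _ => rfl)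
  obtain ⟨F, hF, h0⟩ := exists_constantOnArcs h1
  obtain ⟨G, hG, hG'⟩ := hF.births (m := 0) (s := s) (by simpa only [zero_add] using h0)
  rw [← List.append_assoc] at hG
  have hpt (q : ℕ) (hq : q < n) : IsPoint b.closure.word (n, n + q) := by
    refine ⟨2 * n, ?_, by dsimp only; omega⟩
    have h2 : b.closure.word.take n = (List.range n).map birth := by
      show (closureWord n b.word).take n = _
      rw [closureWord, List.append_assoc]
      exact List.take_left' (by simp)
    dsimp only
    rw [h2, run_births]
  have key : G n (n + q) = G n (n + 0) := by
    have h3 := h.2 _ _ (hpt q hq) (hpt 0 (by omega))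
    have h4 (x y) (hxy : Relation.EqvGen (Joined b.closure.word) x y) : G x.1 x.2 = G y.1 y.2 := by
      induction hxy with
      | rel x y h => exact hG x y h
      | refl => rfl
      | symm _ _ _ ih => exact ih.symm
      | trans _ _ _ _ _ ih₁ ih₂ => exact ih₁.trans ih₂
    exact h4 _ _ h3
  have h5 (q : ℕ) (hq : q < n) : G n (n + q) = s q := by
    have := hG' 0
    rw [add_zero] at this
    rw [this, h0]
    simp only [closureState]
    grind
  rw [h5 q hq, h5 0 (by omega)] at key
  exact iff_of_eq key

/-! ### A colouring in which no classical crossing has index zero -/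

/-- These are the conditions for the excess labels of `(i, j, k)`: the virtual sweep moves a strand
by one place, or from one end of the braid to the other. Going once around a single cycle, the unit
steps and the jump by `card X - 1` add up to zero, and the values met on the way are distinct. -/
theorem exists_height {X : Type*} [Fintype X] (f : Equiv.Perm X) (x₀ : X)
    (hf : ∀ x, f.SameCycle x x₀) :
    ∃ h : X → ℤ, Function.Injective h ∧ (∀ x, f x ≠ x₀ → h x = h (f x) - 1) ∧
      ∀ x, f x = x₀ → h x = h x₀ + (Fintype.card X - 1) := by
  classical
  have hex (y : X) : ∃ m : ℕ, (f ^ m) y = x₀ := by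
    obtain ⟨m, -, -, hm⟩ := (hf y).exists_pow_eq''
    exact ⟨m, hm⟩
  let e : X → ℕ := fun y => Nat.find (hex y)
  have he (y : X) : (f ^ e y) y = x₀ := Nat.find_spec (hex y)
  have he0 : e x₀ = 0 := (Nat.find_eq_zero _).2 rfl
  have hstep (y : X) (hy : y ≠ x₀) : e y = e (f y) + 1 := by
    refine (Nat.find_eq_iff (hex y)).2 ⟨?_, fun m hm => ?_⟩
    · rw [pow_succ, Equiv.Perm.mul_apply]
      exact he (f y)
    · cases m with
      | zero => exact hy
      | succ m =>
        rw [pow_succ, Equiv.Perm.mul_apply]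
        exact Nat.find_min (hex (f y)) (Nat.lt_of_succ_lt_succ hm)
  -- `e y` is the number of steps from `y` to `x₀`, so `h` takes the values `0, -1, …, 1 - card X`.
  let h : X → ℤ := fun x => -(e (f x) : ℤ)
  have h1 (x : X) (hx : f x ≠ x₀) : h x = h (f x) - 1 := by
    simp only [h]
    rw [hstep _ hx]
    push_cast
    ring
  have h2 (x : X) (hx : f x = x₀) : h x = 0 := by simp [h, hx, he0]
  refine ⟨h, fun x y hxy => ?_, h1, fun x hx => ?_⟩
  · have h3 : e (f x) = e (f y) := by simpa [h] using hxy
    have h4 := he (f x)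
    rw [h3, ← he (f y)] at h4
    exact f.injective ((f ^ e (f y)).injective h4)
  -- The size of the jump comes from summation: both sums agree, and each of the other `card X - 1`
  -- elements contributes a difference of one.
  · have h3 : ∑ y, h (f y) = ∑ y, h y := Equiv.sum_comp f h
    rw [← Finset.add_sum_erase _ _ (Finset.mem_univ x),
      ← Finset.add_sum_erase _ h (Finset.mem_univ x)] at h3
    have h4 : ∑ y ∈ Finset.univ.erase x, h y = ∑ y ∈ Finset.univ.erase x, (h (f y) - 1) :=
      Finset.sum_congr rfl fun y hy => h1 y fun h' =>
        (Finset.mem_erase.1 hy).1 (f.injective (h'.trans hx.symm))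
    rw [h4, Finset.sum_sub_distrib, hx, Finset.sum_const,
      Finset.card_erase_of_mem (Finset.mem_univ x), Finset.card_univ] at h3
    have h5 : 1 ≤ Fintype.card X := Fintype.card_pos_iff.2 ⟨x⟩
    rw [nsmul_eq_mul, Nat.cast_sub h5] at h3
    push_cast at h3
    linarith

/-- Strands that are oriented to the right, with labels that exceed those of a classical braid
by `h`. -/
def labels (h : ℕ → ℤ) : ℕ → ℤˣ × ℤ := fun q => (1, h q - q)

/-- With `h = 0` the integer at each place is the same before and after a crossing. Hence in general
the excess `h` travels along the strands. -/
theorem act_labels {w : List (Crossing × ℕ)} (hw : ∀ x ∈ w, x.1 = .over) (h : ℕ → ℤ) :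
    affinePalette.act w (labels h) = labels (h ∘ perm w) := by
  induction w generalizing h with
  | nil => rfl
  | cons x w ih =>
    rw [perm, Equiv.Perm.coe_mul, ← Function.comp_assoc,
      ← ih fun y hy => hw y (List.mem_cons_of_mem _ hy), act, hw x List.mem_cons_self]
    congr 1
    funext q
    simp only [crossAt, affinePalette, labels, Crossing.sign, Function.comp,
      Equiv.swap_apply_def, Units.val_one]
    split_ifs <;> grind

/-- A crossing has index zero only if its two strands have the same excess, which injectivity
forbids; so each letter weighs one. -/
theorem weight_labels {n : ℕ} {w : List (Crossing × ℕ)} (hw : ∀ x ∈ w, x.1 = .over)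
    (hn : ∀ x ∈ w, x.2 + 1 < n) {h : ℕ → ℤ} (hh : ∀ p < n, ∀ q < n, h p = h q → p = q) :
    affinePalette.weight w (labels h) = w.length := by
  induction w generalizing h with
  | nil => rfl
  | cons x w ih =>
    have hx := hn x List.mem_cons_self
    have h1 : affinePalette.crossAt x.1 x.2 (labels h) =
        labels (h ∘ Equiv.swap x.2 (x.2 + 1)) := by
      have := act_labels (w := [x]) (by simpa using hw x List.mem_cons_self) h
      simpa [act, perm] using this
    have h2 : affinePalette.wt x.1 (labels h x.2) (labels h (x.2 + 1)) = 1 := by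
      have h3 : h x.2 ≠ h (x.2 + 1) := fun h' => by
        have := hh _ (by omega) _ (by omega) h'
        omega
      simp only [affinePalette, labels, hw x List.mem_cons_self, Crossing.sign]
      rw [if_neg]
      · simp
      · push_cast
        intro h4
        apply h3
        linarith
    rw [weight, h1, h2, ih (fun y hy => hw y (List.mem_cons_of_mem _ hy))
      (fun y hy => hn y (List.mem_cons_of_mem _ hy))]
    · simp [add_comm]
    · intro p hp q hq hpq
      refine (Equiv.swap x.2 (x.2 + 1)).injective (hh _ ?_ _ ?_ hpq) <;>
        rw [Equiv.swap_apply_def] <;> split_ifs <;> omega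

theorem act_virtual {w : List (Crossing × ℕ)} (hw : ∀ x ∈ w, x.1 = .virt) (s : ℕ → ℤˣ × ℤ) :
    affinePalette.act w s = s ∘ perm w := by
  induction w generalizing s with
  | nil => rfl
  | cons x w ih =>
    rw [act, ih fun y hy => hw y (List.mem_cons_of_mem _ hy), perm, Equiv.Perm.coe_mul,
      ← Function.comp_assoc, hw x List.mem_cons_self]
    congr 1
    funext q
    simp only [crossAt, affinePalette, Crossing.sign, Function.comp, Equiv.swap_apply_def]
    grind

theorem weight_virtual {w : List (Crossing × ℕ)} (hw : ∀ x ∈ w, x.1 = .virt) (s : ℕ → ℤˣ × ℤ) :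
    affinePalette.weight w s = 0 := by
  induction w generalizing s with
  | nil => rfl
  | cons x w ih =>
    rw [weight, ih fun y hy => hw y (List.mem_cons_of_mem _ hy), hw x List.mem_cons_self]
    simp [affinePalette, Crossing.sign]

theorem perm_sweep (n : ℕ) (c : Crossing) (q : ℕ) :
    perm (sweep n c) q = if q + 1 < n then q + 1 else if q + 1 = n then 0 else q := by
  obtain _ | n := n
  · simp [sweep, perm]
  rw [sweep, Nat.add_sub_cancel]
  induction n generalizing q with
  | zero => simp [perm]
  | succ n ih =>
    rw [List.range_succ, List.map_append, perm_append, Equiv.Perm.mul_apply, ih]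
    simp only [List.map_cons, List.map_nil, perm, mul_one, Equiv.swap_apply_def]
    grind

theorem lt_of_mem_sweep (n : ℕ) (c : Crossing) : ∀ x ∈ sweep n c, x.2 + 1 < n := by
  intro x hx
  obtain ⟨m, hm, rfl⟩ := List.mem_map.1 hx
  have := List.mem_range.1 hm
  show m + 1 < n
  omega

theorem exists_labels {n : ℕ} {w : List (Crossing × ℕ)} (hn : 0 < n)
    (hw : ∀ x ∈ w, x.1 = .over) (hv : ∀ x ∈ w, x.2 + 1 < n) (hc : Conn n (sweep n .virt ++ w)) :
    ∃ s, (∀ q < n, affinePalette.act (sweep n .virt ++ w) s q = s q) ∧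
      affinePalette.weight (sweep n .virt ++ w) s = w.length := by
  have hsv : ∀ x ∈ sweep n .virt, x.2 + 1 < n := lt_of_mem_sweep n .virt
  have hs : ∀ x ∈ sweep n .virt, x.1 = .virt := by
    intro x hx
    obtain ⟨m, _, rfl⟩ := List.mem_map.1 hx
    rfl
  have hv' : ∀ x ∈ sweep n .virt ++ w, x.2 + 1 < n := fun x hx =>
    (List.mem_append.1 hx).elim (hsv x) (hv x)
  let f : Equiv.Perm {q // q < n} :=
    (perm (sweep n .virt ++ w)).subtypePerm fun q => perm_lt_iff hv' q
  have hf : ∀ x, f.SameCycle x ⟨0, hn⟩ := by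
    -- The cycle of `0` is an invariant set, so by connectedness it is everything.
    have h1 := hc (fun q => ∃ hq : q < n, f.SameCycle ⟨q, hq⟩ ⟨0, hn⟩) ?_
    · intro x
      exact ((h1 x.1 x.2).2 ⟨hn, .refl _ _⟩).2
    · intro q hq
      constructor
      · rintro ⟨_, h⟩
        exact ⟨hq, Equiv.Perm.sameCycle_apply_left.1 h⟩
      · rintro ⟨_, h⟩
        exact ⟨(perm_lt_iff hv' q).2 hq, Equiv.Perm.sameCycle_apply_left.2 h⟩
  let _ : Fintype {q // q < n} := Fintype.ofEquiv (Fin n) Fin.equivSubtype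
  obtain ⟨h, hinj, h1, h2⟩ := exists_height f _ hf
  let g : ℕ → ℤ := fun q => if hq : q < n then h ⟨q, hq⟩ else 0
  -- Virtual crossings carry the integers `g q - q` along unchanged; `g'` is the excess relative to
  -- the new places.
  let g' : ℕ → ℤ := fun q => g (perm (sweep n .virt) q) - perm (sweep n .virt) q + q
  -- The closing condition. A strand that the sweep takes from place `perm w q + 1` gives the unit
  -- step of `h`, the one that it takes from place `0` gives the jump.
  have hg : ∀ q < n, g' (perm w q) = g q := by
    intro q hq
    have h3 : f ⟨q, hq⟩ = ⟨perm (sweep n .virt) (perm w q), by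
        rw [perm_lt_iff hsv, perm_lt_iff hv]; exact hq⟩ := by
      apply Subtype.ext
      show perm _ q = _
      rw [perm_append]
      rfl
    have h4 := (perm_lt_iff hv q).2 hq
    have h5 := perm_sweep n .virt (perm w q)
    have h6 := h1 ⟨q, hq⟩
    have h7 := h2 ⟨q, hq⟩
    have hcard : Fintype.card {q // q < n} = n := by
      rw [← Fintype.card_congr Fin.equivSubtype, Fintype.card_fin]
    rw [h3] at h6 h7
    rw [hcard] at h7
    simp only [g', g, dif_pos hq]
    rw [dif_pos (by rw [perm_lt_iff hsv, perm_lt_iff hv]; exact hq)]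
    by_cases h8 : perm w q + 1 < n
    · rw [if_pos h8] at h5
      rw [h6 (by simp [h5])]
      have : (perm (sweep n .virt) (perm w q) : ℤ) = perm w q + 1 := by omega
      linarith
    · rw [if_neg h8, if_pos (by omega)] at h5
      rw [h7 (by simp [h5])]
      simp only [h5]
      have : (perm w q : ℤ) = n - 1 := by omega
      rw [this]
      push_cast
      ring
  have hact : affinePalette.act (sweep n .virt) (labels g) = labels g' := by
    rw [act_virtual hs]
    funext q
    simp [labels, g']
  have hinj' : ∀ p < n, ∀ q < n, g' p = g' q → p = q := by
    intro p hp q hq hpq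
    obtain ⟨p, rfl⟩ := (perm w).surjective p
    obtain ⟨q, rfl⟩ := (perm w).surjective q
    rw [perm_lt_iff hv] at hp hq
    rw [hg p hp, hg q hq] at hpq
    simp only [g, dif_pos hp, dif_pos hq] at hpq
    have := congrArg Subtype.val (hinj hpq)
    exact congrArg _ this
  refine ⟨labels g, fun q hq => ?_, ?_⟩
  · rw [act_append, hact, act_labels hw]
    simp [labels, hg q hq]
  · rw [weight_append, weight_virtual hs, hact, weight_labels hw hv hinj', zero_add]

/-! ### Isotopies of words, conjugation and destabilization of closed braids -/

theorem Diagram.eq_of_word {D E : Diagram} (h : D.word = E.word) : D = E := by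
  cases D; cases E; cases h; rfl

/-- The words may be exchanged in every diagram, without changing its virtual link. -/
def Isotopic (u v : List Event) : Prop :=
  (∀ n, run n u = run n v) ∧
    ∀ (D E : Diagram) (a b : List Event), D.word = a ++ u ++ b → E.word = a ++ v ++ b →
      D.Equivalent E

namespace Isotopic

theorem refl (u : List Event) : Isotopic u u :=
  ⟨fun _ => rfl, fun D E _ _ hD hE => by
    rw [Diagram.eq_of_word (hD.trans hE.symm)]
    exact .refl _⟩

theorem symm {u v : List Event} (h : Isotopic u v) : Isotopic v u :=
  ⟨fun n => (h.1 n).symm, fun D E a b hD hE => (h.2 E D a b hE hD).symm⟩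

/-- Equal strand counts make the intermediate word a closed diagram. -/
theorem trans {u v w : List Event} (h : Isotopic u v) (h' : Isotopic v w) : Isotopic u w := by
  refine ⟨fun n => (h.1 n).trans (h'.1 n), fun D E a b hD hE => ?_⟩
  have hc : run 0 (a ++ v ++ b) = some 0 := by
    rw [← D.closed, hD, run_append, run_append, run_append, run_append]
    simp only [h.1]
  exact (h.2 D ⟨_, hc⟩ a b hD rfl).trans _ _ _ (h'.2 ⟨_, hc⟩ E a b rfl hE)

theorem context {u v : List Event} (h : Isotopic u v) (a b : List Event) :
    Isotopic (a ++ u ++ b) (a ++ v ++ b) :=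
  ⟨fun n => by simp only [run_append, h.1], fun D E a' b' hD hE =>
    h.2 D E (a' ++ a) (b ++ b') (by simp [hD]) (by simp [hE])⟩

theorem append {u u' v v' : List Event} (h : Isotopic u u') (h' : Isotopic v v') :
    Isotopic (u ++ v) (u' ++ v') := by
  have h1 := h.context [] v
  have h2 := h'.context u' []
  simp only [List.nil_append, List.append_nil] at h1 h2
  exact h1.trans h2

theorem of_localMove {l r : List Event} (h : LocalMove l r) (hr : ∀ n, run n l = run n r) :
    Isotopic l r :=
  ⟨hr, fun _ _ a b hD hE => .rel _ _ ⟨a, b, l, r, h, hD, hE⟩⟩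

theorem exchange (a b : Piece) (p r : ℕ) :
    Isotopic [⟨a, p⟩, ⟨b, p + a.out + r⟩] [⟨b, p + a.inn + r⟩, ⟨a, p⟩] :=
  of_localMove (.exchange a b p r) fun n => by simp only [run]; grind

theorem slide_birth (c : Crossing) (p : ℕ) :
    Isotopic [birth (p + 1), cross c p] [birth p, cross c.flip (p + 1)] :=
  of_localMove (.slide_birth c p) fun n => by
    simp only [run, birth, cross, Piece.inn, Piece.out]; grind

theorem slide_death (c : Crossing) (p : ℕ) :
    Isotopic [cross c p, death (p + 1)] [cross c.flip (p + 1), death p] :=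
  of_localMove (.slide_death c p) fun n => by
    simp only [run, death, cross, Piece.inn, Piece.out]; grind

theorem kink_death (c : Crossing) (p : ℕ) : Isotopic [cross c p, death p] [death p] :=
  of_localMove (.kink_death c p) fun n => by
    simp only [run, death, cross, Piece.inn, Piece.out]; grind

theorem triangle {x y z : Crossing} (h : TriangleMove x y z) (p : ℕ) :
    Isotopic [cross x p, cross y (p + 1), cross z p]
      [cross z (p + 1), cross y p, cross x (p + 1)] :=
  of_localMove (.triangle h p) fun n => by
    simp only [run, cross, Piece.inn, Piece.out]; grind

end Isotopic

theorem Crossing.flip_flip (c : Crossing) : c.flip.flip = c := by cases c <;> rfl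

/-- The innermost returning strands cross instead of the strands `p` and `p + 1` of the braid. -/
theorem births_cross (c : Crossing) (m p : ℕ) :
    Isotopic ((List.range (m + 2 + p)).map birth ++ [cross c (m + 2 + p + p)])
      ((List.range (m + 2 + p)).map birth ++ [cross c m]) := by
  induction p with
  | zero =>
    -- One slide turns the two nested arcs into arcs side by side, a second one nests them the other
    -- way round. The two flips of the crossing cancel.
    have h1 : Isotopic [birth m, birth (m + 1), cross c (m + 2)]
        [birth m, birth (m + 1), cross c m] := by
      have h2 := (Isotopic.slide_birth c.flip (m + 1)).symm.context [birth m] []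
      have h3 := (Isotopic.exchange .birth .birth m 0).context [] [cross c.flip (m + 1)]
      have h4 := (Isotopic.slide_birth c m).symm.context [birth m] []
      rw [Crossing.flip_flip] at h2
      exact h2.trans (h3.trans h4)
    rw [add_zero, List.range_succ, List.range_succ]
    simpa using h1.context ((List.range m).map birth) []
  | succ p ih =>
    rw [show m + 2 + (p + 1) + (p + 1) = m + 2 + p + 2 + p by omega,
      show m + 2 + (p + 1) = m + 2 + p + 1 by omega, List.range_succ]
    simp only [List.map_append, List.map_cons, List.map_nil, List.append_assoc,
      List.cons_append, List.nil_append]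
    have h1 := (Isotopic.exchange .birth (.cross c) (m + 2 + p) p).context
      ((List.range (m + 2 + p)).map birth) []
    have h2 := ih.context [] [birth (m + 2 + p)]
    have h3 := (Isotopic.exchange (.cross c) .birth m p).context
      ((List.range (m + 2 + p)).map birth) []
    simp only [List.append_assoc, List.nil_append, List.append_nil, List.cons_append,
      Piece.inn, Piece.out, add_zero] at h1 h2 h3
    exact h1.trans (h2.trans h3)

theorem cross_deaths (c : Crossing) (m p : ℕ) :
    Isotopic (cross c (m + 2 + p + p) :: (List.range (m + 2 + p)).reverse.map death)
      (cross c m :: (List.range (m + 2 + p)).reverse.map death) := by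
  induction p with
  | zero =>
    have h1 : Isotopic [cross c (m + 2), death (m + 1), death m]
        [cross c m, death (m + 1), death m] := by
      have h2 := (Isotopic.slide_death c.flip (m + 1)).symm.context [] [death m]
      have h3 := (Isotopic.exchange .death .death m 0).symm.context [cross c.flip (m + 1)] []
      have h4 := (Isotopic.slide_death c m).symm.context [] [death m]
      rw [Crossing.flip_flip] at h2
      exact h2.trans (h3.trans h4)
    rw [add_zero, List.range_succ, List.range_succ]
    simpa using h1.context [] ((List.range m).reverse.map death)
  | succ p ih =>
    rw [show m + 2 + (p + 1) + (p + 1) = m + 2 + p + 2 + p by omega,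
      show m + 2 + (p + 1) = m + 2 + p + 1 by omega, List.range_succ, List.reverse_append, List.reverse_singleton,
      List.singleton_append, List.map_cons]
    have h1 := (Isotopic.exchange .death (.cross c) (m + 2 + p) p).symm.context []
      ((List.range (m + 2 + p)).reverse.map death)
    have h2 := ih.context [death (m + 2 + p)] []
    have h3 := (Isotopic.exchange (.cross c) .death m p).symm.context []
      ((List.range (m + 2 + p)).reverse.map death)
    simp only [List.nil_append, List.append_nil, List.cons_append,
      Piece.inn, Piece.out, add_zero] at h1 h2 h3
    exact h1.trans (h2.trans h3)

/-- The part of a diagram of a closed braid on `n` strands that belongs to the braid word `w`. -/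
def braidEvents (n : ℕ) (w : List (Crossing × ℕ)) : List Event :=
  w.map fun x => cross x.1 (n + x.2)

theorem braidEvents_append (n : ℕ) (u v : List (Crossing × ℕ)) :
    braidEvents n (u ++ v) = braidEvents n u ++ braidEvents n v := List.map_append

theorem cross_braidEvents (c : Crossing) (m p : ℕ) (w : List (Crossing × ℕ)) :
    Isotopic (cross c m :: braidEvents (m + 2 + p) w)
      (braidEvents (m + 2 + p) w ++ [cross c m]) := by
  induction w with
  | nil => exact .refl _
  | cons x w ih =>
    have h1 := (Isotopic.exchange (.cross c) (.cross x.1) m (p + x.2)).context []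
      (braidEvents (m + 2 + p) w)
    have h2 := ih.context [cross x.1 (m + 2 + p + x.2)] []
    simp only [List.nil_append, List.append_nil, List.cons_append,
      Piece.inn, Piece.out, ← add_assoc] at h1 h2
    exact h1.trans h2

/-- The letter slides around the births onto the returning strands, passes above the rest of the
braid and comes back around the deaths. -/
theorem closureWord_rotate_one {n : ℕ} {x : Crossing × ℕ} (hx : x.2 + 1 < n)
    (w : List (Crossing × ℕ)) : Isotopic (closureWord n (x :: w)) (closureWord n (w ++ [x])) := by
  obtain ⟨c, p⟩ := x
  obtain ⟨m, rfl⟩ : ∃ m, n = m + 2 + p := ⟨n - 2 - p, by dsimp only at hx; omega⟩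
  have h1 := (births_cross c m p).context []
    (braidEvents (m + 2 + p) w ++ (List.range (m + 2 + p)).reverse.map death)
  have h2 := (cross_braidEvents c m p w).context ((List.range (m + 2 + p)).map birth)
    ((List.range (m + 2 + p)).reverse.map death)
  have h3 := (cross_deaths c m p).symm.context
    ((List.range (m + 2 + p)).map birth ++ braidEvents (m + 2 + p) w) []
  simp only [List.append_assoc, List.nil_append, List.append_nil, List.cons_append] at h1 h2 h3
  have h4 := h1.trans (h2.trans h3)
  simpa [closureWord, braidEvents] using h4

theorem closureWord_rotate {n : ℕ} {u : List (Crossing × ℕ)} (hu : ∀ x ∈ u, x.2 + 1 < n)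
    (w : List (Crossing × ℕ)) : Isotopic (closureWord n (u ++ w)) (closureWord n (w ++ u)) := by
  induction u generalizing w with
  | nil => simpa using Isotopic.refl _
  | cons x u ih =>
    have h1 := closureWord_rotate_one (hu x List.mem_cons_self) (u ++ w)
    have h2 := ih (fun y hy => hu y (List.mem_cons_of_mem _ hy)) (w ++ [x])
    simp only [List.append_assoc, List.cons_append, List.nil_append] at h1 h2
    exact h1.trans h2

/-- The innermost strand of a closed braid is removed. -/
theorem closureWord_destabilize (c : Crossing) (n : ℕ) (w : List (Crossing × ℕ))
    (D E : Diagram) (hD : D.word = closureWord (n + 1) ((c, 0) :: w.map fun x => (x.1, x.2 + 1)))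
    (hE : E.word = closureWord n w) : D.Equivalent E := by
  have hcomm : Isotopic (braidEvents (n + 2) w ++ [death n]) (death n :: braidEvents n w) := by
    clear D E hD hE
    induction w with
    | nil => exact .refl _
    | cons x w ih =>
      have h1 := (Isotopic.exchange .death (.cross x.1) n x.2).symm.context []
        (braidEvents n w)
      have h2 := ih.context [cross x.1 (n + 2 + x.2)] []
      simp only [List.nil_append, List.append_nil, List.cons_append,
        Piece.inn, Piece.out] at h1 h2
      exact h2.trans h1
  -- The crossing slides around the birth, where it forms a kink with the death; the zigzag left
  -- over is straightened at the end.
  have h1 : Isotopic [birth n, cross c (n + 1), death n] [birth (n + 1), death n] := by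
    have h2 := (Isotopic.slide_birth c.flip n).symm.context [] [death n]
    have h3 := (Isotopic.kink_death c.flip n).context [birth (n + 1)] []
    rw [Crossing.flip_flip] at h2
    exact h2.trans h3
  have h2 := hcomm.context ((List.range n).map birth ++ [birth n, cross c (n + 1)])
    ((List.range n).reverse.map death)
  have h3 := h1.context ((List.range n).map birth)
    (braidEvents n w ++ (List.range n).reverse.map death)
  simp only [List.append_assoc, List.nil_append, List.cons_append] at h2 h3
  have h4 := h2.trans h3
  have hD' : D.word = (List.range n).map birth ++ birth n :: cross c (n + 1) ::
      (braidEvents (n + 2) w ++ death n :: (List.range n).reverse.map death) := by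
    rw [hD, closureWord, List.range_succ]
    simp [braidEvents, Function.comp_def, add_comm, add_left_comm]
  rw [← hD'] at h4
  have hc := D.closed
  rw [h4.1] at hc
  refine (h4.2 D ⟨_, hc⟩ [] [] (by simp) (by simp)).trans _ _ _ (.rel _ _ ?_)
  refine ⟨(List.range n).map birth, braidEvents n w ++ (List.range n).reverse.map death, _, _,
    .zigzag_down n, by simp, ?_⟩
  rw [hE, closureWord]
  simp [braidEvents]

/-! ### Braid words up to braid relations and crossing changes -/

/-- All letters of the braid word are crossings of the first `n` strands. -/
def Valid (n : ℕ) (w : List (Crossing × ℕ)) : Prop := ∀ x ∈ w, x.2 + 1 < n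

theorem valid_append {n : ℕ} {u v : List (Crossing × ℕ)} :
    Valid n (u ++ v) ↔ Valid n u ∧ Valid n v := List.forall_mem_append

/-- The braid word of a positive braid. -/
def positive (w : List ℕ) : List (Crossing × ℕ) := w.map fun p => (.over, p)

theorem positive_append (u v : List ℕ) : positive (u ++ v) = positive u ++ positive v :=
  List.map_append

/-- Two braid words that represent the same virtual braid, related by moves that preserve the
length. -/
structure BraidEq (u v : List (Crossing × ℕ)) : Prop where
  isotopic (n : ℕ) : Isotopic (braidEvents n u) (braidEvents n v)
  perm_eq : perm u = perm v
  valid_iff (n : ℕ) : Valid n u ↔ Valid n v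
  length_eq : u.length = v.length

namespace BraidEq

theorem refl (u : List (Crossing × ℕ)) : BraidEq u u := ⟨fun _ => .refl _, rfl, fun _ => .rfl, rfl⟩

theorem symm {u v : List (Crossing × ℕ)} (h : BraidEq u v) : BraidEq v u :=
  ⟨fun n => (h.1 n).symm, h.2.symm, fun n => (h.3 n).symm, h.4.symm⟩

theorem trans {u v w : List (Crossing × ℕ)} (h : BraidEq u v) (h' : BraidEq v w) : BraidEq u w :=
  ⟨fun n => (h.1 n).trans (h'.1 n), h.2.trans h'.2, fun n => (h.3 n).trans (h'.3 n), h.4.trans h'.4⟩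

theorem append {u u' v v' : List (Crossing × ℕ)} (h : BraidEq u u') (h' : BraidEq v v') :
    BraidEq (u ++ v) (u' ++ v') where
  isotopic n := by
    rw [braidEvents_append, braidEvents_append]
    exact (h.1 n).append (h'.1 n)
  perm_eq := by rw [perm_append, perm_append, h.2, h'.2]
  valid_iff n := by rw [valid_append, valid_append, h.3, h'.3]
  length_eq := by rw [List.length_append, List.length_append, h.4, h'.4]

theorem comm_of_lt (c d : Crossing) {p q : ℕ} (h : p + 2 ≤ q) :
    BraidEq [(c, p), (d, q)] [(d, q), (c, p)] where
  isotopic n := by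
    obtain ⟨r, rfl⟩ := Nat.exists_eq_add_of_le h
    have := Isotopic.exchange (.cross c) (.cross d) (n + p) r
    simpa only [braidEvents, List.map_cons, List.map_nil, cross, Piece.inn, Piece.out, add_assoc]
      using this
  perm_eq := by
    ext x
    simp only [perm, mul_one, Equiv.Perm.mul_apply, Equiv.swap_apply_def]
    grind
  valid_iff n := by simp [Valid, and_comm]
  length_eq := rfl

theorem triangle {x y z : Crossing} (h : TriangleMove x y z) (p : ℕ) :
    BraidEq [(x, p), (y, p + 1), (z, p)] [(z, p + 1), (y, p), (x, p + 1)] where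
  isotopic n := Isotopic.triangle h (n + p)
  perm_eq := by
    ext x
    simp only [perm, mul_one, Equiv.Perm.mul_apply, Equiv.swap_apply_def]
    grind
  valid_iff n := by simp [Valid]; tauto
  length_eq := rfl

theorem comm_letter {x : Crossing × ℕ} {u : List (Crossing × ℕ)}
    (h : ∀ y ∈ u, y.2 + 2 ≤ x.2 ∨ x.2 + 2 ≤ y.2) : BraidEq (u ++ [x]) (x :: u) := by
  induction u with
  | nil => exact refl _
  | cons y u ih =>
    have h1 : BraidEq [y, x] [x, y] := by
      rcases h y List.mem_cons_self with h | h
      · exact comm_of_lt _ _ h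
      · exact (comm_of_lt _ _ h).symm
    exact ((refl [y]).append (ih fun z hz => h z (List.mem_cons_of_mem _ hz))).trans
      (h1.append (refl u))

end BraidEq

/-- A closed braid diagram with this word becomes the unknot by `m` crossing changes. -/
def UnknotsIn (n m : ℕ) (w : List (Crossing × ℕ)) : Prop :=
  ∀ hw : Valid n w, UnknottedBy m (VirtualBraid.closure ⟨w, hw⟩)

theorem BraidEq.unknotsIn {u v : List (Crossing × ℕ)} (h : BraidEq u v) {n m : ℕ}
    (hv : UnknotsIn n m v) : UnknotsIn n m u := fun hu =>
  (hv ((h.3 n).1 hu)).of_equivalent ((h.1 n).2 _ _ ((List.range n).map birth)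
    ((List.range n).reverse.map death) rfl rfl)

theorem unknotsIn_rotate {n m : ℕ} {u v : List (Crossing × ℕ)} (h : UnknotsIn n m (v ++ u)) :
    UnknotsIn n m (u ++ v) := fun huv => by
  have hu := (valid_append.1 huv).1
  have hv := (valid_append.1 huv).2
  exact (h (valid_append.2 ⟨hv, hu⟩)).of_equivalent
    ((closureWord_rotate hu v).2 _ _ [] [] (by simp [VirtualBraid.closure])
      (by simp [VirtualBraid.closure]))

/-- `m` crossing changes, each of which allows to remove two letters, lead from one braid word to
the other one. -/
structure Reduces (m : ℕ) (u v : List (Crossing × ℕ)) : Prop where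
  length_eq : u.length = v.length + 2 * m
  perm_eq : perm u = perm v
  valid (n : ℕ) : Valid n u → Valid n v
  unknotsIn (n k : ℕ) (a b : List (Crossing × ℕ)) :
    UnknotsIn n k (a ++ v ++ b) → UnknotsIn n (k + m) (a ++ u ++ b)

namespace Reduces

theorem of_braidEq {u v : List (Crossing × ℕ)} (h : BraidEq u v) : Reduces 0 u v :=
  ⟨h.4, h.2, fun n => (h.3 n).1, fun _ _ a b =>
    (((BraidEq.refl a).append h).append (BraidEq.refl b)).unknotsIn⟩

theorem trans {m m' : ℕ} {u v w : List (Crossing × ℕ)} (h : Reduces m u v) (h' : Reduces m' v w) :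
    Reduces (m + m') u w where
  length_eq := by rw [h.1, h'.1]; ring
  perm_eq := h.2.trans h'.2
  valid n := h'.3 n ∘ h.3 n
  unknotsIn n k a b hw := by
    rw [add_comm m, ← add_assoc]
    exact h.4 _ _ _ _ (h'.4 _ _ _ _ hw)

theorem context {m : ℕ} {u v : List (Crossing × ℕ)} (h : Reduces m u v)
    (a b : List (Crossing × ℕ)) : Reduces m (a ++ u ++ b) (a ++ v ++ b) where
  length_eq := by simp [h.1]; ring
  perm_eq := by simp only [perm_append, h.2]
  valid n := by
    simp only [valid_append]
    exact fun ⟨⟨ha, hu⟩, hb⟩ => ⟨⟨ha, h.3 n hu⟩, hb⟩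
  unknotsIn n k a' b' := by
    simpa using h.4 n k (a' ++ a) (b ++ b')

/-- Changing the second of the two crossings makes the pair a bigon. -/
theorem cancel (c : Crossing) (hc : c ≠ .virt) (p : ℕ) : Reduces 1 [(c, p), (c, p)] [] where
  length_eq := rfl
  perm_eq := by simp [perm]
  valid n _ := by simp [Valid]
  unknotsIn n k a b h hw := by
    have hw' : Valid n (a ++ [(c, p), (c.flip, p)] ++ b) := by
      rw [valid_append, valid_append] at hw ⊢
      exact ⟨⟨hw.1.1, by simpa [Valid] using hw.1.2⟩, hw.2⟩
    have hw0 : Valid n (a ++ [] ++ b) := by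
      rw [valid_append, valid_append] at hw ⊢
      exact ⟨⟨hw.1.1, by simp [Valid]⟩, hw.2⟩
    refine .succ (.refl _) (F := VirtualBraid.closure ⟨_, hw'⟩)
      ⟨(List.range n).map birth ++ braidEvents n a ++ [cross c (n + p)],
        braidEvents n b ++ (List.range n).reverse.map death, c, n + p, hc, ?_, ?_⟩ ?_
    · simp [VirtualBraid.closure, closureWord, braidEvents]
    · simp [VirtualBraid.closure, closureWord, braidEvents]
    · refine (h hw0).of_equivalent (.rel _ _ ⟨(List.range n).map birth ++ braidEvents n a,
        braidEvents n b ++ (List.range n).reverse.map death, _, _, .bigon c (n + p), ?_, ?_⟩)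
      · simp [VirtualBraid.closure, closureWord, braidEvents]
      · simp [VirtualBraid.closure, closureWord, braidEvents]

end Reduces

/-! ### Normal form of positive words -/

/-- The letters `k + l - 1, …, k + 1, k`. -/
def descent (k l : ℕ) : List ℕ := (List.range' k l).reverse

theorem descent_succ (k l : ℕ) : descent k (l + 1) = descent (k + 1) l ++ [k] := by
  simp [descent, List.range'_succ]

theorem descent_add (k l m : ℕ) : descent k (l + m) = descent (k + l) m ++ descent k l := by
  rw [descent, ← List.range'_append_1, List.reverse_append]
  rfl

theorem mem_descent {k l p : ℕ} : p ∈ descent k l ↔ k ≤ p ∧ p < k + l := by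
  simp [descent, List.mem_range'_1]

theorem comm_positive {p : ℕ} {u : List ℕ} (h : ∀ q ∈ u, q + 2 ≤ p ∨ p + 2 ≤ q) :
    BraidEq (positive (u ++ [p])) (positive (p :: u)) := by
  rw [positive_append]
  refine BraidEq.comm_letter fun y hy => ?_
  obtain ⟨q, hq, rfl⟩ := List.mem_map.1 hy
  exact h q hq

/-- The letter `p + 1` commutes with the lower end of the descent, one braid relation with `p + 1,
p` turns it into `p`, and this commutes with the upper end. -/
theorem descent_comm {k l p : ℕ} (hk : k ≤ p) (hl : p + 1 < k + l) :
    BraidEq (positive (descent k l ++ [p + 1])) (positive (p :: descent k l)) := by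
  obtain ⟨a, rfl⟩ := Nat.exists_eq_add_of_le hk
  obtain ⟨b, rfl⟩ : ∃ b, l = a + 2 + b := ⟨l - a - 2, by omega⟩
  have h0 : descent k (a + 2 + b) = descent (k + a + 2) b ++ [k + a + 1, k + a] ++ descent k a := by
    rw [descent_add, descent_add, descent_succ, descent_succ]
    simp [descent, add_assoc]
  have h1 : BraidEq (positive (descent k a ++ [k + a + 1])) (positive ((k + a + 1) :: descent k a)) :=
    comm_positive fun q hq => by have := mem_descent.1 hq; omega
  have h2 : BraidEq (positive (descent (k + a + 2) b ++ [k + a]))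
      (positive ((k + a) :: descent (k + a + 2) b)) :=
    comm_positive fun q hq => by have := mem_descent.1 hq; omega
  have h3 : BraidEq (positive [k + a, k + a + 1, k + a]) (positive [k + a + 1, k + a, k + a + 1]) :=
    .triangle (.classical (by simp) (by simp) (by simp) (by simp) (by simp)) _
  have h4 := (BraidEq.refl (positive (descent (k + a + 2) b ++ [k + a + 1, k + a]))).append h1
  have h5 := ((BraidEq.refl (positive (descent (k + a + 2) b))).append h3.symm).append
    (.refl (positive (descent k a)))
  have h6 := h2.append (.refl (positive ([k + a + 1, k + a] ++ descent k a)))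
  rw [h0]
  simp only [← positive_append, List.append_assoc, List.cons_append, List.nil_append] at h4 h5 h6 ⊢
  exact h4.trans (h5.trans h6)

/-- Normal form of positive braids up to crossing changes: only a descent involves the last
strand. -/
theorem exists_reduces {N : ℕ} (w : List ℕ) (hw : ∀ p ∈ w, p < N) :
    ∃ (v : List ℕ) (m k l : ℕ), k + l = N ∧ (∀ p ∈ v, p + 1 < N) ∧
      Reduces m (positive w) (positive (v ++ descent k l)) := by
  induction w using List.reverseRecOn with
  | nil => exact ⟨[], 0, N, 0, rfl, by simp, .of_braidEq (.refl _)⟩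
  | append_singleton w p ih =>
    obtain ⟨v, m, k, l, hkl, hv, hr⟩ := ih fun q hq => hw q (List.mem_append_left _ hq)
    have hp : p < N := hw p (by simp)
    have hr' : Reduces m (positive (w ++ [p])) (positive (v ++ descent k l ++ [p])) := by
      simpa [positive_append] using hr.context [] (positive [p])
    -- A new letter `p` commutes with the descent if `p + 1 < k`, prolongs it if `p + 1 = k`,
    -- cancels its last letter by a crossing change if `p = k`, and passes through it as `p - 1` if
    -- `p > k`.
    rcases lt_trichotomy p k with h | rfl | h
    · rcases Nat.lt_or_eq_of_le (Nat.succ_le_of_lt h) with h | rfl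
      · refine ⟨v ++ [p], m, k, l, hkl, ?_, ?_⟩
        · intro q hq
          rcases List.mem_append.1 hq with hq | hq
          · exact hv q hq
          · have := List.mem_singleton.1 hq
            omega
        · have h1 : BraidEq (positive (descent k l ++ [p])) (positive (p :: descent k l)) :=
            comm_positive fun q hq => by have := mem_descent.1 hq; omega
          have h2 := hr'.trans (v := positive (v ++ descent k l ++ [p]))
            (.of_braidEq (by simpa [positive_append] using (BraidEq.refl (positive v)).append h1))
          simpa [positive] using h2
      · refine ⟨v, m, p, l + 1, by omega, hv, ?_⟩
        simpa [descent_succ] using hr'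
    · obtain ⟨l, rfl⟩ : ∃ l', l = l' + 1 := ⟨l - 1, by omega⟩
      refine ⟨v, m + 1, p + 1, l, by omega, hv, hr'.trans ?_⟩
      have h1 := (Reduces.cancel .over (by simp) p).context (positive (v ++ descent (p + 1) l)) []
      simpa [descent_succ, positive] using h1
    · obtain ⟨p, rfl⟩ : ∃ p', p = p' + 1 := ⟨p - 1, by omega⟩
      refine ⟨v ++ [p], m, k, l, hkl, ?_, ?_⟩
      · intro q hq
        rcases List.mem_append.1 hq with hq | hq
        · exact hv q hq
        · have := List.mem_singleton.1 hq
          omega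
      · have h1 := descent_comm (k := k) (l := l) (p := p) (by omega) (by omega)
        have h2 := hr'.trans (v := positive (v ++ descent k l ++ [p + 1]))
          (.of_braidEq (by simpa [positive_append] using (BraidEq.refl (positive v)).append h1))
        simpa [positive] using h2

/-! ### Removing one strand at a time -/

/-- The braid word on the strands below the first one. -/
def shift (w : List (Crossing × ℕ)) : List (Crossing × ℕ) := w.map fun x => (x.1, x.2 + 1)

theorem Valid.shift {n : ℕ} {w : List (Crossing × ℕ)} (h : Valid n w) :
    Valid (n + 1) (shift w) := by
  intro x hx
  obtain ⟨y, hy, rfl⟩ := List.mem_map.1 hx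
  exact Nat.succ_lt_succ (h y hy)

theorem perm_shift_zero (w : List (Crossing × ℕ)) : perm (shift w) 0 = 0 := by
  induction w with
  | nil => rfl
  | cons x w ih =>
    show Equiv.swap _ _ (perm (shift w) 0) = 0
    rw [ih, Equiv.swap_apply_def]
    simp

theorem perm_shift_succ (w : List (Crossing × ℕ)) (q : ℕ) :
    perm (shift w) (q + 1) = perm w q + 1 := by
  induction w with
  | nil => rfl
  | cons x w ih =>
    show Equiv.swap _ _ (perm (shift w) (q + 1)) = Equiv.swap _ _ (perm w q) + 1
    rw [ih, Equiv.swap_apply_def, Equiv.swap_apply_def]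
    grind

theorem Conn.rotate {n : ℕ} {u v : List (Crossing × ℕ)} (hv : Valid n v) (h : Conn n (u ++ v)) :
    Conn n (v ++ u) := by
  intro s hs
  have h1 := h (fun q => s (perm v q)) fun q hq => by
    have := hs (perm v q) ((perm_lt_iff hv q).2 hq)
    rw [perm_append, Equiv.Perm.mul_apply] at this ⊢
    exact this
  have h2 (q) (hq : q < n) : s q ↔ s (perm v 0) := by
    obtain ⟨q, rfl⟩ := (perm v).surjective q
    exact h1 q ((perm_lt_iff hv q).1 hq)
  exact fun q hq => (h2 q hq).trans (h2 0 (by omega)).symm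

theorem Conn.destabilize {n : ℕ} {c : Crossing} {w : List (Crossing × ℕ)}
    (h : Conn (n + 1) ((c, 0) :: shift w)) : Conn n w := by
  intro s hs q hq
  -- Truncated subtraction gives the places `0` and `1` the same value, as fits the crossing between
  -- them.
  have h1 := h (fun q => s (q - 1)) ?_ (q + 1) (by omega)
  · exact h1
  · intro p hp
    show s (Equiv.swap 0 1 (perm (shift w) p) - 1) ↔ s (p - 1)
    cases p with
    | zero => rw [perm_shift_zero, Equiv.swap_apply_left]
    | succ p =>
      rw [perm_shift_succ, Nat.add_sub_cancel, ← hs p (by omega), Equiv.swap_apply_def]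
      by_cases h0 : perm w p = 0 <;> simp [h0]

theorem perm_reverse (w : List (Crossing × ℕ)) : perm w.reverse = (perm w)⁻¹ := by
  induction w with
  | nil => rfl
  | cons x w ih => simp [perm_append, perm, ih]

theorem perm_descent (N : ℕ) : perm (positive (descent 0 N)) 0 = N := by
  have h : positive (descent 0 N) = (sweep (N + 1) .over).reverse := by
    simp [positive, descent, sweep, List.range_eq_range']
  rw [h, perm_reverse, Equiv.Perm.inv_eq_iff_eq, perm_sweep]
  simp

theorem perm_apply_of_forall_lt {n : ℕ} {w : List (Crossing × ℕ)} (hw : Valid n w) {q : ℕ}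
    (hq : n ≤ q) : perm w q = q := by
  induction w with
  | nil => rfl
  | cons x w ih =>
    have := hw x List.mem_cons_self
    show Equiv.swap _ _ (perm w q) = q
    rw [ih fun y hy => hw y (List.mem_cons_of_mem _ hy), Equiv.swap_apply_of_ne_of_ne] <;> omega

theorem sweep_succ (N : ℕ) (c : Crossing) (hN : 0 < N) :
    sweep (N + 1) c = (c, 0) :: shift (sweep N c) := by
  obtain ⟨N, rfl⟩ : ∃ M, N = M + 1 := ⟨N - 1, by omega⟩
  simp [sweep, shift, List.range_succ_eq_map]

/-- A crossing passes the virtual crossings on the left-most strand of the braid. -/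
theorem sweep_letter (c : Crossing) {N p : ℕ} (hp : p + 1 < N) :
    BraidEq (sweep (N + 1) .virt ++ [(c, p)]) ((c, p + 1) :: sweep (N + 1) .virt) := by
  obtain ⟨r, rfl⟩ : ∃ r, N = p + 2 + r := ⟨N - p - 2, by omega⟩
  let f : ℕ → Crossing × ℕ := fun m => (.virt, m)
  let a := (List.range p).map f
  let b := (List.range' (p + 2) r).map f
  have h0 : sweep (p + 2 + r + 1) .virt = a ++ [f p, f (p + 1)] ++ b := by
    simp only [sweep, Nat.add_sub_cancel, a, b, List.range_eq_range']
    rw [← List.range'_append_1, ← List.range'_append_1]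
    simp [f, List.range'_succ]
  have ha : BraidEq (a ++ [(c, p + 1)]) ((c, p + 1) :: a) := .comm_letter fun y hy => by
    obtain ⟨m, hm, rfl⟩ := List.mem_map.1 hy
    have := List.mem_range.1 hm
    simp only [f]
    omega
  have hb : BraidEq (b ++ [(c, p)]) ((c, p) :: b) := .comm_letter fun y hy => by
    obtain ⟨m, hm, rfl⟩ := List.mem_map.1 hy
    have := List.mem_range'_1.1 hm
    simp only [f]
    omega
  have h1 := (BraidEq.refl (a ++ [f p, f (p + 1)])).append hb
  -- The sweeping strand has virtual crossings with both strands of `c`, so the mixed move applies.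
  have h2 := ((BraidEq.refl a).append (.triangle (.mixed_first c) p)).append (.refl b)
  have h3 := ha.append (.refl ([f p, f (p + 1)] ++ b))
  rw [h0]
  simp only [List.append_assoc, List.cons_append, List.nil_append] at h1 h2 h3 ⊢
  exact h1.trans (h2.trans h3)

theorem sweep_braid {N : ℕ} {w : List (Crossing × ℕ)} (hw : Valid N w) :
    BraidEq (sweep (N + 1) .virt ++ w) (shift w ++ sweep (N + 1) .virt) := by
  induction w with
  | nil => simpa [shift] using BraidEq.refl _
  | cons x w ih =>
    have h1 := (sweep_letter x.1 (hw x List.mem_cons_self)).append (.refl w)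
    have h2 := (BraidEq.refl [(x.1, x.2 + 1)]).append
      (ih fun y hy => hw y (List.mem_cons_of_mem _ hy))
    simp only [List.append_assoc, List.cons_append, List.nil_append] at h1 h2
    exact h1.trans h2

theorem shift_positive (w : List ℕ) : shift (positive w) = positive (w.map (· + 1)) := by
  simp [shift, positive]

theorem valid_positive {n : ℕ} {w : List ℕ} : Valid n (positive w) ↔ ∀ p ∈ w, p + 1 < n := by
  simp [Valid, positive]

/-- Removing the top strand leaves a virtual sweep followed by a positive word on one strand fewer,
so the induction can continue. At one strand no letter is left, which gives the exact count `2 * m =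
w.length`. -/
theorem exists_unknotsIn (N : ℕ) (w : List ℕ) (hw : ∀ p ∈ w, p < N)
    (hc : Conn (N + 1) (sweep (N + 1) .virt ++ positive w)) :
    ∃ m, 2 * m = w.length ∧ UnknotsIn (N + 1) m (sweep (N + 1) .virt ++ positive w) := by
  induction N generalizing w with
  | zero =>
    obtain rfl : w = [] := List.eq_nil_iff_forall_not_mem.2 fun p hp => by simpa using hw p hp
    exact ⟨0, rfl, fun _ => .zero (.refl _)⟩
  | succ N ih =>
    set t := sweep (N + 1 + 1) .virt with ht
    obtain ⟨v, m, k, l, hkl, hv, hr⟩ := exists_reduces w hw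
    have hvalid : Valid (N + 1) (positive v) := valid_positive.2 hv
    have hc1 : Conn (N + 1 + 1) (t ++ positive (v ++ descent k l)) := by
      unfold Conn
      rw [perm_append, ← hr.2, ← perm_append]
      exact hc
    -- A full descent would undo the sweep at place `0`; this place would be fixed and form a
    -- component of its own.
    have hk : k ≠ 0 := by
      rintro rfl
      obtain rfl : l = N + 1 := by omega
      have h0 : perm (t ++ positive (v ++ descent 0 (N + 1))) 0 = 0 := by
        rw [positive_append, perm_append, perm_append, Equiv.Perm.mul_apply,
          Equiv.Perm.mul_apply, perm_descent, perm_apply_of_forall_lt hvalid le_rfl, perm_sweep]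
        simp
      have h1 := hc1 (fun q => q = 0) (fun q _ =>
        ⟨fun h => (perm _).injective (h.trans h0.symm), by rintro rfl; exact h0⟩) 1 (by omega)
      simp at h1
    obtain ⟨k, rfl⟩ := Nat.exists_eq_succ_of_ne_zero hk
    have hd : positive (descent (k + 1) l) = shift (positive (descent k l)) := by
      rw [shift_positive, descent, descent, List.map_reverse]
      congr 2
      simpa only [add_comm] using (List.map_add_range' k l (step := 1) (a := 1)).symm
    -- The factor `v` avoids the last strand, so it passes through the virtual sweep and moves down
    -- by one.
    have hb : BraidEq (t ++ positive (v ++ descent (k + 1) l))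
        (shift (positive v) ++ (t ++ shift (positive (descent k l)))) := by
      rw [positive_append, hd, ← List.append_assoc, ← List.append_assoc]
      exact (sweep_braid hvalid).append (.refl _)
    -- After rotation, the first crossing of the sweep is the only letter that involves the top
    -- strand.
    have hshift : t ++ shift (positive (descent k l)) ++ shift (positive v) =
        (.virt, 0) :: shift (sweep (N + 1) .virt ++ positive (descent k l ++ v)) := by
      rw [ht, sweep_succ _ _ (Nat.succ_pos N)]
      simp [shift, positive]
    have hlt : ∀ p ∈ descent k l ++ v, p < N := by
      intro p hp
      rcases List.mem_append.1 hp with hp | hp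
      · have := mem_descent.1 hp
        omega
      · have := hv p hp
        omega
    have hval : Valid (N + 1) (sweep (N + 1) .virt ++ positive (descent k l ++ v)) := by
      refine valid_append.2 ⟨lt_of_mem_sweep _ _, valid_positive.2 fun p hp => ?_⟩
      have := hlt p hp
      omega
    have hdv : Valid (N + 1) (positive (descent k l)) := valid_positive.2 fun p hp => by
      have := hlt p (List.mem_append_left _ hp)
      omega
    have hc2 : Conn (N + 1) (sweep (N + 1) .virt ++ positive (descent k l ++ v)) := by
      refine Conn.destabilize (c := .virt) ?_
      rw [← hshift]
      have hc2 : Conn (N + 1 + 1)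
          (shift (positive v) ++ (t ++ shift (positive (descent k l)))) := by
        unfold Conn
        rw [← hb.2]
        exact hc1
      refine hc2.rotate ?_
      exact valid_append.2 ⟨lt_of_mem_sweep _ _, hdv.shift⟩
    obtain ⟨m', hm', hu⟩ := ih _ hlt hc2
    refine ⟨m' + m, ?_, ?_⟩
    · have := hr.1
      simp only [positive, List.length_map, List.length_append] at this hm'
      simp [descent] at this hm'
      omega
    · have h1 : UnknotsIn (N + 1 + 1) m' (t ++ positive (v ++ descent (k + 1) l)) := by
        refine hb.unknotsIn (unknotsIn_rotate ?_)
        rw [hshift]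
        exact fun _ => (hu hval).of_equivalent
          (closureWord_destabilize .virt (N + 1) _ _ _ rfl rfl)
      simpa using hr.4 (N + 1 + 1) m' t [] (by simpa using h1)

/-! ### The virtual knots `(i, j, k)` -/

theorem torusDiagram_word (i j k : ℕ) (hk : k < i) :
    ∃ w : List ℕ, w.length = (i - 1) * (j - 1) + k ∧ (∀ p ∈ w, p + 1 < i) ∧
      ((VB i j).mul (B i k hk)).word = sweep i .virt ++ positive w := by
  refine ⟨(List.replicate (j - 1) (List.range (i - 1))).flatten ++ (List.range k).reverse, ?_, ?_,
    ?_⟩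
  · simp [mul_comm]
  · intro p hp
    rcases List.mem_append.1 hp with hp | hp
    · obtain ⟨l, hl, hp⟩ := List.mem_flatten.1 hp
      rw [List.eq_of_mem_replicate hl] at hp
      have := List.mem_range.1 hp
      omega
    · have := List.mem_range.1 (List.mem_reverse.1 hp)
      omega
  · simp [VirtualBraid.mul, VB, B, positive, sweep, List.map_flatten]

end VirtualKnot

open VirtualKnot in
theorem theorem2 (i j k : ℕ) (hj : 0 < j) (hk : k < i)
    (hknot : (VirtualKnot.torusDiagram i j k hk).IsKnot) :
    (VirtualKnot.torusDiagram i j k hk).VirtuallyNullHomotopic ∧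
      (VirtualKnot.virtualUnknottingNumber (VirtualKnot.torusDiagram i j k hk) : ℚ) =
        (((i : ℚ) - 1) * ((j : ℚ) - 1) + (k : ℚ)) / 2 := by
  obtain ⟨w, hlen, hlt, hw⟩ := torusDiagram_word i j k hk
  have hc := conn_of_isKnot _ hknot
  rw [hw] at hc
  have hi : 0 < i := by omega
  obtain ⟨N, rfl⟩ : ∃ N, i = N + 1 := ⟨i - 1, by omega⟩
  obtain ⟨m, hm, hu⟩ := exists_unknotsIn N w (fun p hp => by have := hlt p hp; omega) hc
  have hval : Valid (N + 1) (sweep (N + 1) .virt ++ positive w) :=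
    valid_append.2 ⟨lt_of_mem_sweep _ _, valid_positive.2 hlt⟩
  have hunk : UnknottedBy m (torusDiagram (N + 1) j k hk) := by
    convert hu hval using 1
    exact Diagram.eq_of_word (congrArg (closureWord (N + 1)) hw)
  refine ⟨hunk.virtuallyNullHomotopic, ?_⟩
  obtain ⟨s, hs, hweight⟩ := exists_labels hi (w := positive w) (by simp [positive])
    (valid_positive.2 hlt) hc
  rw [← hw] at hs hweight
  have heval := affinePalette.eval_closure ((VB (N + 1) j).mul (B (N + 1) k hk)) (a := (1, 0))
    (fun x => by simp [affinePalette]) hs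
  rw [hweight] at heval
  have hnum : virtualUnknottingNumber (torusDiagram (N + 1) j k hk) = m := by
    refine le_antisymm (Nat.sInf_le hunk) ?_
    -- The infimum is attained because `m` belongs to the set, so the lower bound applies to it.
    have h1 := UnknottedBy.abs_le (Nat.sInf_mem (s := {n | UnknottedBy n _}) ⟨m, hunk⟩) heval
    rw [Nat.abs_cast] at h1
    have h2 : (positive w).length = w.length := by simp [positive]
    rw [h2, ← hm] at h1
    unfold virtualUnknottingNumber
    push_cast at h1
    omega
  rw [hnum]
  have h3 : 2 * m = N * (j - 1) + k := by rw [hm, hlen, Nat.add_sub_cancel]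
  have h4 := congrArg (Nat.cast : ℕ → ℚ) h3
  -- Positivity of `j` makes the truncated `j - 1` agree with the rational one.
  push_cast [Nat.cast_sub hj] at h4 ⊢
  rw [eq_div_iff two_ne_zero]
  linarith
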